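/- Let $\mathbb Z\langle X\rangle$ be the free unital associative ring freely generated by a countably infinite set $X=\{x_i \mid i\in\mathbb N\}$. Put $[a,b]=ab-ba$, $[a,b,c]=[[a,b],c]$ and $[a,b,c,d]=[[[a,b],c],d]$. Let $T^{(4)}$ be the two-sided ideal of $\mathbb Z\langle X\rangle$ generated by all elements $[a_1,a_2,a_3,a_4]$, and let $T^{(3,2)}\supseteq T^{(4)}$ be the two-sided ideal generated by all elements $[a_1,a_2,a_3,a_4]$ and $[a_1,a_2][a_3,a_4,a_5]$, where the $a_i$ range over $\mathbb Z\langle X\rangle$. Let $$\mathcal E=\bigl\{\,x_{j_1}\cdots x_{j_l}\,[x_{i_1},x_{i_2}]\cdots[x_{i_{2k-1}},x_{i_{2k}}]\,[x_{i_{2k+1}},x_{i_{2k+2}},x_{i_{2k+3}}] \ \bigm|\ l\ge 0,\ k\ge 1,\ j_1\le\dots\le j_l,\ i_1<\dots<i_{2k+3}\,\bigr\}.$$ Then the additive group $T^{(3,2)}/T^{(4)}$ is an elementary abelian $3$-group (that is, $3b=0$ for all $b$ in it), and the cosets $e+T^{(4)}$, $e\in\mathcal E$, are pairwise distinct and form a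 basis of it as a vector space over $\mathbb F_3=\mathbb Z/3\mathbb Z$. -/

import Mathlib

/-- The free unital associative ring `ℤ⟨X⟩` on the countable ordered set `X = {x_i | i ∈ ℕ}`. -/
abbrev FreeRingX : Type := FreeAlgebra ℤ ℕ

/-- The free generator `x_i`. -/
abbrev gen (i : ℕ) : FreeRingX := FreeAlgebra.ι ℤ i

/-- The commutator `[a, b] = a b - b a`. -/
def comm2 (a b : FreeRingX) : FreeRingX := a * b - b * a

/-- The left-normed commutator `[a, b, c] = [[a, b], c]`. -/
def comm3 (a b c : FreeRingX) : FreeRingX := comm2 (comm2 a b) c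

/-- The left-normed commutator `[a, b, c, d] = [[[a, b], c], d]`. -/
def comm4 (a b c d : FreeRingX) : FreeRingX := comm2 (comm3 a b c) d

/-- `T^{(4)}`: the two-sided ideal generated by all `[a₁, a₂, a₃, a₄]`. -/
def T4 : TwoSidedIdeal FreeRingX :=
  TwoSidedIdeal.span {f | ∃ a b c d : FreeRingX, f = comm4 a b c d}

/-- `T^{(3,2)}`: the two-sided ideal generated by all `[a₁, a₂, a₃, a₄]` and all
`[a₁, a₂] [a₃, a₄, a₅]`. -/
def T32 : TwoSidedIdeal FreeRingX :=
  TwoSidedIdeal.span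
    ({f | ∃ a b c d : FreeRingX, f = comm4 a b c d} ∪
      {f | ∃ a b c d e : FreeRingX, f = comm2 a b * comm3 c d e})

theorem T4_le_T32 : T4 ≤ T32 := TwoSidedIdeal.span_mono Set.subset_union_left

/-- The additive group `T^{(3,2)} / T^{(4)}`. -/
abbrev QuotT32T4 : Type :=
  AddSubgroup.ofClass T32 ⧸ (AddSubgroup.ofClass T4).addSubgroupOf (AddSubgroup.ofClass T32)

/-- The element
`x_{j_1} ⋯ x_{j_l} [x_{i_1}, x_{i_2}] ⋯ [x_{i_{2k-1}}, x_{i_{2k}}] [x_{i_{2k+1}}, x_{i_{2k+2}}, x_{i_{2k+3}}]`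
(the families `j` and `i` are indexed from `0` here). -/
def basisElt {l k : ℕ} (j : Fin l → ℕ) (i : Fin (2 * k + 3) → ℕ) : FreeRingX :=
  (List.ofFn fun s : Fin l => gen (j s)).prod *
    (List.ofFn fun m : Fin k =>
      comm2 (gen (i ⟨2 * m, by omega⟩)) (gen (i ⟨2 * m + 1, by omega⟩))).prod *
    comm3 (gen (i ⟨2 * k, by omega⟩)) (gen (i ⟨2 * k + 1, by omega⟩))
      (gen (i ⟨2 * k + 2, by omega⟩))

/-- The set `ℰ` of all these elements with `l ≥ 0`, `k ≥ 1`, `j_1 ≤ ⋯ ≤ j_l` and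
`i_1 < ⋯ < i_{2k+3}`. -/
def calE : Set FreeRingX :=
  {f | ∃ (l k : ℕ) (j : Fin l → ℕ) (i : Fin (2 * k + 3) → ℕ),
    1 ≤ k ∧ Monotone j ∧ StrictMono i ∧ f = basisElt j i}

theorem calE_subset_T32 {f : FreeRingX} (hf : f ∈ calE) : f ∈ AddSubgroup.ofClass T32 := by
  obtain ⟨l, k, j, i, hk, -, -, rfl⟩ := hf
  obtain ⟨n, rfl⟩ : ∃ n, k = n + 1 := ⟨k - 1, by omega⟩
  change _ ∈ T32
  rw [basisElt, List.ofFn_succ', List.concat_eq_append, List.prod_append, List.prod_singleton,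
    ← mul_assoc, mul_assoc]
  exact T32.mul_mem_left _ _ (TwoSidedIdeal.subset_span (Or.inr ⟨_, _, _, _, _, rfl⟩))

/-- The image `e + T^{(4)}` of an element `e ∈ ℰ` in `T^{(3,2)} / T^{(4)}`. -/
def cosetE (e : calE) : QuotT32T4 :=
  QuotientAddGroup.mk ⟨(e : FreeRingX), calE_subset_T32 e.2⟩

/-!
Two independent arguments show that the cosets of `calE` span `T32 / T4` and that they are
linearly independent over `𝔽₃`.

*Spanning and torsion.* In `ℤ⟨X⟩ / T4` triple commutators are central. Expanding the vanishing
commutators `[u, v, w d, e]` and `[u d, e, v, w]` shows that `[u, v, w] [d, e]` is skew symmetric in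
all five arguments (`LieNilThree.swap34`, `LieNilThree.swap14`). The Jacobi identity then gives
`3 [u, v, w] [d, e] = 0`, and `[u, v, w] [d, e, f] = 0` follows. Hence `[u, v, w] [d, e]` is a
derivation in each argument, which reduces `T32 / T4` to left multiples of
`[x, x] ⋯ [x, x] [x, x, x]`. These products are skew symmetric in their indices
(`LieNilThree.commProd_swap`). The word in front of one is sorted by
`x_i x_j = x_j x_i + [x_i, x_j]`, the new commutator joining the product
(`LieNilThree.gen_mul_mem`).

*Independence.* Let `e_i` be exterior multiplication by `dx_i` and `θ` a further odd constant. On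
forms with coefficients in `𝔽₃[x_0, x_1, …]` the multiplications by the `x_i` are deformed to
operators `X_i` with `[d, X_i] = e_i` and `[X_i, X_j] = e_i e_j (1 + θ d)`. The
deformation depends on the order of the variables and needs characteristic `3`
(`WeylGrassmann.lie_secondOrder_x_of_lt`). With `δ a = [d, a]` one has, for all `a, b, c` in the ring
generated by the `X_i`,

  `[a, b, c] = θ δa δb δc`   and   `[a, b] [c, d] + [a, c] [b, d] = 0`,

by simultaneous induction on the degree (`FormModel.mon_aux`); each identity passes to products by
means of the other, and modulo `θ` the `δ a` are anticommuting constants. So triple commutators are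
central and `T4` acts as zero. Applied to the form `1`, the element of `calE` with indices `j` and `i`
yields exactly `θ x_{j_1} ⋯ x_{j_l} dx_{i_1} ⋯ dx_{i_{2k+3}}` (`Form.rep_apply`), because the
corrections in `X_i` differentiate only in variables before the `i`-th; these forms are distinct
members of a basis.
-/

/-! ### Commutators in a ring that is Lie nilpotent of class at most three -/

section LieNilpotent

attribute [local instance] LieRing.ofAssociativeRing

variable {R : Type*} [Ring R]

theorem lie_mul_right' (a b c : R) : ⁅a, b * c⁆ = b * ⁅a, c⁆ + ⁅a, b⁆ * c := by
  simp only [Ring.lie_def]; noncomm_ring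

theorem lie_mul_left' (a b c : R) : ⁅a * b, c⁆ = a * ⁅b, c⁆ + ⁅a, c⁆ * b := by
  simp only [Ring.lie_def]; noncomm_ring

theorem mul_eq_mul_add_lie (a b : R) : a * b = b * a + ⁅a, b⁆ := by
  simp only [Ring.lie_def]; noncomm_ring

/-- Lie nilpotency of class at most `3`: all commutators `[a, b, c, d]` vanish. -/
def LieNilThree (R : Type*) [Ring R] : Prop :=
  ∀ a b c d : R, ⁅⁅⁅a, b⁆, c⁆, d⁆ = 0

namespace LieNilThree

theorem commute (h : LieNilThree R) (a b c d : R) : ⁅⁅a, b⁆, c⁆ * d = d * ⁅⁅a, b⁆, c⁆ :=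
  sub_eq_zero.1 (h a b c d)

theorem swap12 (u v w d e : R) : ⁅⁅u, v⁆, w⁆ * ⁅d, e⁆ = -(⁅⁅v, u⁆, w⁆ * ⁅d, e⁆) := by
  rw [← lie_skew u v, neg_lie, neg_mul]

theorem swap45 (u v w d e : R) : ⁅⁅u, v⁆, w⁆ * ⁅d, e⁆ = -(⁅⁅u, v⁆, w⁆ * ⁅e, d⁆) := by
  rw [← lie_skew d e, mul_neg]

/-- Expand `[u, v, w d, e] = 0`. -/
theorem swap34 (h : LieNilThree R) (u v w d e : R) :
    ⁅⁅u, v⁆, w⁆ * ⁅d, e⁆ = -(⁅⁅u, v⁆, d⁆ * ⁅w, e⁆) := by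
  have := h u v (w * d) e
  rw [lie_mul_right', add_lie, lie_mul_left', lie_mul_left', h, h, ← h.commute u v d] at this
  simp only [mul_zero, zero_add, zero_mul, add_zero] at this
  exact eq_neg_of_add_eq_zero_right this

theorem swap35 (h : LieNilThree R) (u v w d e : R) :
    ⁅⁅u, v⁆, w⁆ * ⁅d, e⁆ = -(⁅⁅u, v⁆, e⁆ * ⁅d, w⁆) := by
  rw [h.swap34, swap45, h.swap34 u v d e w]; simp

/-- Expand `[u d, e, v, w] = 0` and use the skew symmetry that `swap34` gives. -/
theorem swap14 (h : LieNilThree R) (u v w d e : R) :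
    ⁅⁅u, v⁆, w⁆ * ⁅d, e⁆ = -(⁅⁅d, v⁆, w⁆ * ⁅u, e⁆) := by
  have h1 := h (u * d) e v w
  have e1 : ⁅⁅u * d, e⁆, v⁆ =
      u * ⁅⁅d, e⁆, v⁆ + ⁅u, v⁆ * ⁅d, e⁆ + ⁅u, e⁆ * ⁅d, v⁆ + ⁅⁅u, e⁆, v⁆ * d := by
    rw [lie_mul_left', add_lie, lie_mul_left', lie_mul_left']; abel
  rw [e1] at h1
  simp only [add_lie, lie_mul_left', h d e v w, h u e v w, mul_zero, zero_mul, add_zero,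
    zero_add] at h1
  -- Each product is written with the triple commutator first.
  rw [← h.commute d e v, ← h.commute d e w, ← h.commute d v w, h.swap35 d e v u w,
    h.swap35 u e v d w] at h1
  rw [← sub_eq_zero, sub_neg_eq_add, ← h1]
  abel

theorem swap23 (h : LieNilThree R) (u v w d e : R) :
    ⁅⁅u, v⁆, w⁆ * ⁅d, e⁆ = -(⁅⁅u, w⁆, v⁆ * ⁅d, e⁆) := by
  rw [swap12, h.swap14 v u w d e, h.swap34 d u, h.swap14 d u v w e, swap12]
  simp

theorem swap15 (h : LieNilThree R) (u v w d e : R) :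
    ⁅⁅u, v⁆, w⁆ * ⁅d, e⁆ = -(⁅⁅e, v⁆, w⁆ * ⁅d, u⁆) := by
  rw [swap45, h.swap14 u v w e d, swap45 e v w u d]
  simp

theorem swap25 (h : LieNilThree R) (u v w d e : R) :
    ⁅⁅u, v⁆, w⁆ * ⁅d, e⁆ = -(⁅⁅u, e⁆, w⁆ * ⁅d, v⁆) := by
  rw [swap12, h.swap15 v u w d e, swap12 e u]
  simp

/-- The Jacobi identity multiplied by a commutator. -/
theorem three_nsmul (h : LieNilThree R) (u v w d e : R) :
    3 • (⁅⁅u, v⁆, w⁆ * ⁅d, e⁆) = 0 := by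
  have h1 : (⁅⁅u, v⁆, w⁆ + ⁅⁅v, w⁆, u⁆ + ⁅⁅w, u⁆, v⁆) * ⁅d, e⁆ = 0 := by
    rw [← zero_mul ⁅d, e⁆]; congr 1
    simp only [Ring.lie_def]; noncomm_ring
  rw [add_mul, add_mul] at h1
  have h2 : ⁅⁅v, w⁆, u⁆ * ⁅d, e⁆ = ⁅⁅u, v⁆, w⁆ * ⁅d, e⁆ := by
    rw [h.swap23 v w u, swap12 v u]; simp
  have h3 : ⁅⁅w, u⁆, v⁆ * ⁅d, e⁆ = ⁅⁅u, v⁆, w⁆ * ⁅d, e⁆ := by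
    rw [swap12 w u, h.swap23 u w v]; simp
  rw [h2, h3] at h1
  rw [← h1]; abel

/-- By `swap14` the product is `-[[d, e], v, w] [u, f]`. -/
theorem mul_triple (h : LieNilThree R) (u v w d e f : R) :
    ⁅⁅u, v⁆, w⁆ * ⁅⁅d, e⁆, f⁆ = 0 := by
  rw [h.swap14, h, zero_mul, neg_zero]

end LieNilThree
end LieNilpotent

/-! ### Spanning by ordered monomials -/

section Spanning

attribute [local instance] LieRing.ofAssociativeRing

variable {R : Type*} [Ring R]

/-- The product `[x_a, x_b] ⋯ [x_c, x_d] [x_e, x_f, x_g]` of commutators of the members of a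
family `x` listed by `[a, b, …, c, d, e, f, g]`. Its value is `0` on lists of even length and on
lists of length `1`. -/
def commProd (x : ℕ → R) : List ℕ → R
  | [a, b, c] => ⁅⁅x a, x b⁆, x c⁆
  | a :: b :: c :: d :: l => ⁅x a, x b⁆ * commProd x (c :: d :: l)
  | _ => 0

/-- Commutator products end in a triple commutator, so that a factor which annihilates the triple
commutators annihilates them too. -/
theorem commProd_eq_mul_triple (x : ℕ → R) : ∀ l : List ℕ,
    ∃ y a b c : R, commProd x l = y * ⁅⁅a, b⁆, c⁆
  | [a, b, c] => ⟨1, x a, x b, x c, by rw [commProd, one_mul]⟩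
  | a :: b :: c :: d :: l => by
    obtain ⟨y, u, v, w, h⟩ := commProd_eq_mul_triple x (c :: d :: l)
    exact ⟨⁅x a, x b⁆ * y, u, v, w, by rw [commProd, h, mul_assoc]⟩
  | [] | [_] | [_, _] => ⟨0, 0, 0, 0, by simp [commProd]⟩

namespace LieNilThree

theorem triple_mul_commProd (h : LieNilThree R) (x : ℕ → R) (u v w : R) (l : List ℕ) :
    ⁅⁅u, v⁆, w⁆ * commProd x l = 0 := by
  obtain ⟨y, a, b, c, hl⟩ := commProd_eq_mul_triple x l
  rw [hl, ← mul_assoc, h.commute, mul_assoc, h.mul_triple, mul_zero]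

theorem lie_mul_commProd (h : LieNilThree R) (x : ℕ → R) (u v w : R) (l : List ℕ) :
    ⁅u, v⁆ * (w * commProd x l) = w * (⁅u, v⁆ * commProd x l) := by
  rw [← mul_assoc, mul_eq_mul_add_lie ⁅u, v⁆, add_mul, h.triple_mul_commProd, add_zero, mul_assoc]

theorem lie_mul_triple_comm (h : LieNilThree R) (u v p q r : R) :
    ⁅u, v⁆ * ⁅⁅p, q⁆, r⁆ = ⁅p, q⁆ * ⁅⁅u, v⁆, r⁆ := by
  rw [← h.commute, ← h.commute, h.swap14 p q r u v, h.swap25 u q r p v, neg_neg]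

/-- The product `[a, b] [c, d]` is skew symmetric in `b` and `c` on multiples of triple
commutators. -/
theorem lie_mul_lie_mul_triple (h : LieNilThree R) (a b c d p q r : R) :
    ⁅a, b⁆ * (⁅c, d⁆ * ⁅⁅p, q⁆, r⁆) = -(⁅a, c⁆ * (⁅b, d⁆ * ⁅⁅p, q⁆, r⁆)) := by
  have key : ∀ a b c d : R, ⁅a, b⁆ * (⁅c, d⁆ * ⁅⁅p, q⁆, r⁆) = ⁅p, q⁆ * (⁅a, b⁆ * ⁅⁅c, d⁆, r⁆) := by
    intro a b c d
    rw [h.lie_mul_triple_comm c d, ← mul_assoc, mul_eq_mul_add_lie ⁅a, b⁆, add_mul, h.mul_triple,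
      add_zero, mul_assoc]
  rw [key, key, ← h.commute c d r, ← h.commute b d r, h.swap15 c d r a b, mul_neg]

theorem lie_mul_lie_mul_commProd (h : LieNilThree R) (x : ℕ → R) (a b c d : R) (l : List ℕ) :
    ⁅a, b⁆ * (⁅c, d⁆ * commProd x l) = -(⁅a, c⁆ * (⁅b, d⁆ * commProd x l)) := by
  obtain ⟨y, p, q, r, hl⟩ := commProd_eq_mul_triple x l
  have key : ∀ a b c d : R, ⁅a, b⁆ * (⁅c, d⁆ * commProd x l) =
      y * (⁅a, b⁆ * (⁅c, d⁆ * ⁅⁅p, q⁆, r⁆)) := by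
    intro a b c d
    have hc : ∀ a b s : R, ⁅a, b⁆ * (y * (s * ⁅⁅p, q⁆, r⁆)) = y * (⁅a, b⁆ * (s * ⁅⁅p, q⁆, r⁆)) := by
      intro a b s
      rw [← mul_assoc, mul_eq_mul_add_lie ⁅a, b⁆, add_mul, ← mul_assoc ⁅⁅a, b⁆, y⁆, h.commute,
        mul_assoc s, h.mul_triple, mul_zero, add_zero, mul_assoc]
    have := hc c d 1
    rw [one_mul] at this
    rw [hl, this, hc]
  rw [key, key, h.lie_mul_lie_mul_triple, mul_neg]

/-- Exchanging two neighbours in the list changes the sign. The list must have a length other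
than `3`: `[a, b, c]` itself is not skew symmetric in `b` and `c`. -/
theorem commProd_swap (h : LieNilThree R) (x : ℕ → R) (a b : ℕ) (q : List ℕ) :
    ∀ p : List ℕ, (p ++ a :: b :: q).length ≠ 3 →
      commProd x (p ++ a :: b :: q) = -commProd x (p ++ b :: a :: q)
  | [], hp => by
    match q with
    | [] => simp [commProd]
    | [_] => simp at hp
    | c :: d :: q =>
      simp only [List.nil_append, commProd]
      rw [← lie_skew, neg_mul]
  | [z], hp => by
    match q with
    | [] => simp at hp
    | [_] => simp [commProd]
    | [c, d] =>
      simp only [List.cons_append, List.nil_append, commProd]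
      rw [← h.commute, ← h.commute, h.swap15]
    | c :: d :: e :: q =>
      simp only [List.cons_append, List.nil_append]
      match q with
      | [] => simp [commProd]
      | f :: q => simpa only [commProd] using h.lie_mul_lie_mul_commProd x _ _ _ _ _
  | y :: z :: p, hp => by
    match p, q with
    | [], [] => simp [commProd]
    | [], [c] => 
      simp only [List.cons_append, List.nil_append, commProd]
      rw [← h.commute, ← h.commute, swap12]
    | [c], [] =>
      simp only [List.cons_append, List.nil_append, commProd]
      rw [← h.commute, ← h.commute, h.swap23]
    | [], c :: d :: q =>
      have := commProd_swap h x a b (c :: d :: q) [] (by simp)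
      simp only [List.cons_append, List.nil_append] at this ⊢
      simp only [commProd.eq_2, this, mul_neg]
    | [e], c :: q =>
      have := commProd_swap h x a b (c :: q) [e] (by simp)
      simp only [List.cons_append, List.nil_append] at this ⊢
      simp only [commProd.eq_2, this, mul_neg]
    | e :: f :: p, q =>
      have := commProd_swap h x a b q (e :: f :: p) (by simp; omega)
      simp only [List.cons_append] at this ⊢
      simp only [commProd.eq_2, this, mul_neg]

/-- The prefix `p` makes the induction on permutations go through. -/
theorem commProd_perm_append (h : LieNilThree R) (x : ℕ → R) {l l' : List ℕ} (hl : l.Perm l') :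
    ∀ p : List ℕ, (p ++ l).length ≠ 3 →
      commProd x (p ++ l) = commProd x (p ++ l') ∨ commProd x (p ++ l) = -commProd x (p ++ l') := by
  induction hl with
  | nil => intro p _; exact Or.inl rfl
  | cons z _ ih =>
    intro p hp
    simpa using ih (p ++ [z]) (by simpa using hp)
  | swap a b q => intro p hp; exact Or.inr (h.commProd_swap x b a q p hp)
  | trans h1 h2 ih1 ih2 =>
    intro p hp
    have hp' := hp
    rw [List.length_append, h1.length_eq, ← List.length_append] at hp'
    rcases ih1 p hp with e1 | e1 <;> rcases ih2 p hp' with e2 | e2 <;> simp [e1, e2]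

theorem commProd_perm (h : LieNilThree R) (x : ℕ → R) {l l' : List ℕ} (hl : l.Perm l')
    (h3 : l.length ≠ 3) : commProd x l = commProd x l' ∨ commProd x l = -commProd x l' :=
  h.commProd_perm_append x hl [] h3

theorem commProd_eq_zero_of_not_nodup (h : LieNilThree R) (x : ℕ → R) {l : List ℕ}
    (h3 : l.length ≠ 3) (hl : ¬ l.Nodup) : commProd x l = 0 := by
  obtain ⟨a, ha⟩ := List.exists_duplicate_iff_not_nodup.2 hl
  have hp : ∃ q, l.Perm (a :: a :: q) := by
    exact (List.duplicate_iff_sublist.1 ha).exists_perm_append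
  obtain ⟨q, hq⟩ := hp
  have h0 : commProd x (a :: a :: q) = 0 := by
    match q with
    | [] => rfl
    | [_] => exact absurd hq.length_eq h3
    | c :: d :: q => rw [commProd, lie_self, zero_mul]
  rcases h.commProd_perm x hq h3 with e | e <;> simp [e, h0]

end LieNilThree
end Spanning

/-! ### Straightening -/

section Straightening

attribute [local instance] LieRing.ofAssociativeRing

variable {R : Type*} [Ring R]

/-- The additive group generated by the products of an ordered word in the `x_a`, `j ≤ a`, and a
commutator product `commProd x l` with `l` strictly increasing of odd length at least `5`. -/
def orderedSpan (x : ℕ → R) (j : ℕ) : AddSubgroup R :=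
  AddSubgroup.closure {r | ∃ v l : List ℕ, v.Pairwise (· ≤ ·) ∧ (∀ a ∈ v, j ≤ a) ∧
    l.Pairwise (· < ·) ∧ 5 ≤ l.length ∧ Odd l.length ∧ r = (v.map x).prod * commProd x l}

theorem orderedSpan_anti (x : ℕ → R) {i j : ℕ} (hij : i ≤ j) :
    orderedSpan x j ≤ orderedSpan x i := by
  refine AddSubgroup.closure_mono ?_
  rintro r ⟨v, l, hv, hj, h⟩
  exact ⟨v, l, hv, fun a ha => hij.trans (hj a ha), h⟩

theorem mul_mem_orderedSpan (x : ℕ → R) (j : ℕ) {r : R} (hr : r ∈ orderedSpan x j) :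
    x j * r ∈ orderedSpan x j := by
  induction hr using AddSubgroup.closure_induction with
  | mem r hr =>
    obtain ⟨v, l, hv, hj, hl, h5, ho, rfl⟩ := hr
    refine AddSubgroup.subset_closure ⟨j :: v, l, ?_, ?_, hl, h5, ho, ?_⟩
    · exact List.pairwise_cons.2 ⟨hj, hv⟩
    · simpa using hj
    · simp [mul_assoc]
  | zero => simp
  | add a b _ _ ha hb => rw [mul_add]; exact add_mem ha hb
  | neg a _ ha => rw [mul_neg]; exact neg_mem ha

namespace LieNilThree

/-- The indices of a commutator product may be put in increasing order, up to sign. -/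
theorem prod_mul_commProd_mem (h : LieNilThree R) (x : ℕ → R) (j : ℕ) {v l : List ℕ}
    (hv : v.Pairwise (· ≤ ·)) (hj : ∀ a ∈ v, j ≤ a) (h5 : 5 ≤ l.length) (ho : Odd l.length) :
    (v.map x).prod * commProd x l ∈ orderedSpan x j := by
  by_cases hl : l.Nodup
  · have hp := List.perm_insertionSort (· ≤ ·) l
    have hm : (v.map x).prod * commProd x (l.insertionSort (· ≤ ·)) ∈ orderedSpan x j := by
      refine AddSubgroup.subset_closure ⟨v, _, hv, hj, ?_, ?_, ?_, rfl⟩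
      · have h1 := List.pairwise_insertionSort (· ≤ ·) l
        have h2 : (l.insertionSort (· ≤ ·)).Nodup := hp.nodup_iff.2 hl
        exact (List.Pairwise.and h1 h2).imp fun h => lt_of_le_of_ne h.1 h.2
      · rwa [hp.length_eq]
      · rwa [hp.length_eq]
    rcases h.commProd_perm x hp.symm (by omega) with e | e
    · rwa [e]
    · rw [e, mul_neg]; exact neg_mem hm
  · rw [h.commProd_eq_zero_of_not_nodup x (by omega) hl, mul_zero]
    exact zero_mem _

/-- A generator multiplied from the left is moved to its place in the ordered word; every
commutator that this produces is moved right, to the commutator product. -/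
theorem gen_mul_mem (h : LieNilThree R) (x : ℕ → R) (i : ℕ) :
    ∀ (v l : List ℕ) (j : ℕ), v.Pairwise (· ≤ ·) → (∀ a ∈ v, j ≤ a) → j ≤ i → 5 ≤ l.length →
      Odd l.length → x i * ((v.map x).prod * commProd x l) ∈ orderedSpan x j
  | [], l, j, _, _, hji, h5, ho => by
    simpa using h.prod_mul_commProd_mem x j (v := [i]) (by simp) (by simpa using hji) h5 ho
  | a :: v, l, j, hv, hj, hji, h5, ho => by
    by_cases hia : i ≤ a
    · have := h.prod_mul_commProd_mem x j (v := i :: a :: v) (l := l)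
        (List.pairwise_cons.2 ⟨fun b hb => ?_, hv⟩) (List.forall_mem_cons.2 ⟨hji, hj⟩) h5 ho
      · simpa [mul_assoc] using this
      · rcases List.mem_cons.1 hb with rfl | hb
        · exact hia
        · exact hia.trans ((List.pairwise_cons.1 hv).1 b hb)
    · have hv' := List.pairwise_cons.1 hv
      have hja : j ≤ a := hj a (by simp)
      have h1 := mul_mem_orderedSpan x a
        (h.gen_mul_mem x i v l a hv'.2 hv'.1 (le_of_not_ge hia) h5 ho)
      have h2 : (v.map x).prod * commProd x (i :: a :: l) ∈ orderedSpan x j :=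
        h.prod_mul_commProd_mem x j hv'.2 (fun b hb => hja.trans (hv'.1 b hb))
          (by simp; omega) (by simpa [Nat.odd_add] using ho)
      have e : x i * (((a :: v).map x).prod * commProd x l) =
          x a * (x i * ((v.map x).prod * commProd x l)) +
            (v.map x).prod * commProd x (i :: a :: l) := by
        have e1 : commProd x (i :: a :: l) = ⁅x i, x a⁆ * commProd x l := by
          match l, h5 with
          | b :: c :: l, _ => rfl
        rw [e1, ← h.lie_mul_commProd, List.map_cons, List.prod_cons, mul_assoc (x a), ← mul_assoc,
          mul_eq_mul_add_lie (x i), add_mul, mul_assoc]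
      rw [e]
      exact add_mem (orderedSpan_anti x hja h1) h2

theorem gen_mul_mem_orderedSpan (h : LieNilThree R) (x : ℕ → R) (i : ℕ) {r : R}
    (hr : r ∈ orderedSpan x 0) : x i * r ∈ orderedSpan x 0 := by
  induction hr using AddSubgroup.closure_induction with
  | mem r hr =>
    obtain ⟨v, l, hv, hj, hl, h5, ho, rfl⟩ := hr
    exact h.gen_mul_mem x i v l 0 hv hj (Nat.zero_le _) h5 ho
  | zero => simp
  | add a b _ _ ha hb => rw [mul_add]; exact add_mem ha hb
  | neg a _ ha => rw [mul_neg]; exact neg_mem ha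

theorem mul_mem_orderedSpan (h : LieNilThree R) {x : ℕ → R}
    (hx : Subring.closure (Set.range x) = ⊤) (p : R) :
    ∀ r ∈ orderedSpan x 0, p * r ∈ orderedSpan x 0 := by
  have hp : p ∈ Subring.closure (Set.range x) := hx ▸ Subring.mem_top p
  induction hp using Subring.closure_induction with
  | mem p hp => obtain ⟨i, rfl⟩ := hp; exact fun r => h.gen_mul_mem_orderedSpan x i
  | zero => simp
  | one => simp
  | add a b _ _ ha hb => intro r hr; rw [add_mul]; exact add_mem (ha r hr) (hb r hr)
  | neg a _ ha => intro r hr; rw [neg_mul]; exact neg_mem (ha r hr)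
  | mul a b _ _ ha hb => intro r hr; rw [mul_assoc]; exact ha _ (hb r hr)

/-- The map `e ↦ [u, v, w] [d, e]` obeys the Leibniz rule `D (a b) = a D b + b D a`, because
`[u, v, w]` is central and annihilates `[d, a, b]`. -/
theorem triple_mul_lie_mem_of_gen (h : LieNilThree R) {x : ℕ → R}
    (hx : Subring.closure (Set.range x) = ⊤) {u v w d : R}
    (hg : ∀ i, ⁅⁅u, v⁆, w⁆ * ⁅d, x i⁆ ∈ orderedSpan x 0) (e : R) :
    ⁅⁅u, v⁆, w⁆ * ⁅d, e⁆ ∈ orderedSpan x 0 := by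
  have he : e ∈ Subring.closure (Set.range x) := hx ▸ Subring.mem_top e
  induction he using Subring.closure_induction with
  | mem p hp => obtain ⟨i, rfl⟩ := hp; exact hg i
  | zero => simp
  | one => simp [Ring.lie_def]
  | add a b _ _ ha hb => rw [lie_add, mul_add]; exact add_mem ha hb
  | neg a _ ha => rw [lie_neg, mul_neg]; exact neg_mem ha
  | mul a b _ _ ha hb =>
    rw [lie_mul_right', mul_add, ← mul_assoc, h.commute, mul_assoc, mul_eq_mul_add_lie ⁅d, a⁆ b,
      mul_add, h.mul_triple, add_zero, ← mul_assoc _ b, h.commute u v w b, mul_assoc]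
    exact add_mem (h.mul_mem_orderedSpan hx _ _ hb) (h.mul_mem_orderedSpan hx _ _ ha)

theorem triple_mul_lie_mem (h : LieNilThree R) {x : ℕ → R}
    (hx : Subring.closure (Set.range x) = ⊤) (u v w d e : R) :
    ⁅⁅u, v⁆, w⁆ * ⁅d, e⁆ ∈ orderedSpan x 0 := by
  have h0 : ∀ i j k l m, ⁅⁅x i, x j⁆, x k⁆ * ⁅x l, x m⁆ ∈ orderedSpan x 0 := by
    intro i j k l m
    rw [h.commute]
    simpa [commProd] using h.prod_mul_commProd_mem x 0 (v := []) (l := [l, m, i, j, k])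
      (by simp) (by simp) (by simp) ⟨2, rfl⟩
  -- The general element enters in the last slot and is carried to another one by skew symmetry.
  have h1 : ∀ (a : R) (j k l m : ℕ), ⁅⁅a, x j⁆, x k⁆ * ⁅x l, x m⁆ ∈ orderedSpan x 0 := by
    intro a j k l m
    rw [h.swap15]
    exact neg_mem (h.triple_mul_lie_mem_of_gen hx (fun i => h0 _ _ _ _ _) a)
  have h2 : ∀ (a b : R) (k l m : ℕ), ⁅⁅a, b⁆, x k⁆ * ⁅x l, x m⁆ ∈ orderedSpan x 0 := by
    intro a b k l m
    rw [h.swap25]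
    exact neg_mem (h.triple_mul_lie_mem_of_gen hx (fun i => h1 _ _ _ _ _) b)
  have h3 : ∀ (a b c : R) (l m : ℕ), ⁅⁅a, b⁆, c⁆ * ⁅x l, x m⁆ ∈ orderedSpan x 0 := by
    intro a b c l m
    rw [h.swap35]
    exact neg_mem (h.triple_mul_lie_mem_of_gen hx (fun i => h2 _ _ _ _ _) c)
  have h4 : ∀ (a b c d : R) (m : ℕ), ⁅⁅a, b⁆, c⁆ * ⁅d, x m⁆ ∈ orderedSpan x 0 := by
    intro a b c d m
    rw [swap45]
    exact neg_mem (h.triple_mul_lie_mem_of_gen hx (fun i => h3 _ _ _ _ _) d)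
  exact h.triple_mul_lie_mem_of_gen hx (fun i => h4 _ _ _ _ _) e

theorem mul_lie_mul_triple_mul (h : LieNilThree R) (p q a b c d e : R) :
    p * (⁅a, b⁆ * ⁅⁅c, d⁆, e⁆) * q = p * q * (⁅⁅c, d⁆, e⁆ * ⁅a, b⁆) := by
  rw [h.commute c d e ⁅a, b⁆, mul_assoc, mul_assoc ⁅a, b⁆, h.commute c d e q, ← mul_assoc ⁅a, b⁆,
    mul_eq_mul_add_lie ⁅a, b⁆ q, add_mul, h.mul_triple, add_zero, mul_assoc, mul_assoc]

theorem mul_lie_mul_triple_mul_mem (h : LieNilThree R) {x : ℕ → R}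
    (hx : Subring.closure (Set.range x) = ⊤) (p q a b c d e : R) :
    p * (⁅a, b⁆ * ⁅⁅c, d⁆, e⁆) * q ∈ orderedSpan x 0 := by
  rw [h.mul_lie_mul_triple_mul]
  exact h.mul_mem_orderedSpan hx _ _ (h.triple_mul_lie_mem hx _ _ _ _ _)

theorem three_nsmul_mul_lie_mul_triple_mul (h : LieNilThree R) (p q a b c d e : R) :
    3 • (p * (⁅a, b⁆ * ⁅⁅c, d⁆, e⁆) * q) = 0 := by
  rw [h.mul_lie_mul_triple_mul, ← mul_smul_comm, h.three_nsmul, mul_zero]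

end LieNilThree
end Straightening

/-! ### The quotient by `T4` -/

section Quotient

attribute [local instance] LieRing.ofAssociativeRing

variable {R : Type*} [Ring R]

theorem commProd_ofFn (x : ℕ → R) : ∀ (k : ℕ) (i : Fin (2 * k + 3) → ℕ),
    commProd x (List.ofFn i) =
      (List.ofFn fun m : Fin k =>
        ⁅x (i ⟨2 * m, by omega⟩), x (i ⟨2 * m + 1, by omega⟩)⁆).prod *
      ⁅⁅x (i ⟨2 * k, by omega⟩), x (i ⟨2 * k + 1, by omega⟩)⁆, x (i ⟨2 * k + 2, by omega⟩)⁆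
  | 0, i => by simp [List.ofFn_succ, commProd]
  | k + 1, i => by
    have e : List.ofFn i =
        i ⟨0, by omega⟩ :: i ⟨1, by omega⟩ ::
          List.ofFn (fun s : Fin (2 * k + 3) => i ⟨s + 2, by omega⟩) := by
      change List.ofFn (n := 2 * k + 3 + 1 + 1) i = _
      rw [List.ofFn_succ, List.ofFn_succ]
      rfl
    have e' : ∀ s : Fin (2 * k + 3) → ℕ, ∀ a b, commProd x (a :: b :: List.ofFn s) =
        ⁅x a, x b⁆ * commProd x (List.ofFn s) := by
      intro s a b
      rw [List.ofFn_succ, List.ofFn_succ]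
      rfl
    rw [e, e', commProd_ofFn x k, List.ofFn_succ, List.prod_cons, mul_assoc]
    rfl

/-- The elements of `calE` in terms of lists of indices. -/
theorem basisElt_eq {l k : ℕ} (j : Fin l → ℕ) (i : Fin (2 * k + 3) → ℕ) :
    basisElt j i = ((List.ofFn j).map gen).prod * commProd gen (List.ofFn i) := by
  rw [commProd_ofFn, List.map_ofFn, ← mul_assoc]
  rfl

theorem mem_calE_iff (f : FreeRingX) : f ∈ calE ↔
    ∃ v l : List ℕ, v.Pairwise (· ≤ ·) ∧ l.Pairwise (· < ·) ∧ 5 ≤ l.length ∧ Odd l.length ∧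
      f = (v.map gen).prod * commProd gen l := by
  constructor
  · rintro ⟨l, k, j, i, hk, hj, hi, rfl⟩
    refine ⟨List.ofFn j, List.ofFn i, List.pairwise_ofFn.2 fun _ _ h => hj h.le,
      List.pairwise_ofFn.2 fun _ _ h => hi h, by simp; omega, ⟨k + 1, by simp; omega⟩,
      basisElt_eq j i⟩
  · rintro ⟨v, l, hv, hl, h5, ⟨k, hk⟩, rfl⟩
    have hget : ∀ (n : ℕ) (w : List ℕ), w.length = n → ∃ i : Fin n → ℕ, List.ofFn i = w := by
      rintro _ w rfl; exact ⟨w.get, List.ofFn_get w⟩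
    obtain ⟨n, hn⟩ : ∃ n, v.length = n := ⟨_, rfl⟩
    obtain ⟨j, rfl⟩ := hget n v hn
    obtain ⟨i, rfl⟩ := hget (2 * (k - 1) + 3) l (by omega)
    refine ⟨_, k - 1, j, i, by omega, ?_, ?_, (basisElt_eq j i).symm⟩
    · exact fun a b hab => hab.eq_or_lt.elim (fun h => by rw [h]) fun h => List.pairwise_ofFn.1 hv h
    · exact fun a b hab => List.pairwise_ofFn.1 hl hab

theorem map_commProd {S : Type*} [Ring S] (φ : R →+* S) (x : ℕ → R) : ∀ l : List ℕ,
    φ (commProd x l) = commProd (fun i => φ (x i)) l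
  | [a, b, c] => by simp [commProd, Ring.lie_def]
  | a :: b :: c :: d :: l => by
    rw [commProd, commProd, map_mul, map_commProd φ x (c :: d :: l)]
    simp [Ring.lie_def]
  | [] | [_] | [_, _] => by simp [commProd]

/-- The ring `ℤ⟨X⟩ / T4`. -/
abbrev QuotT4 : Type := T4.ringCon.Quotient

theorem mk_eq_zero_iff (f : FreeRingX) : T4.ringCon.mk' f = 0 ↔ f ∈ T4 := by
  rw [← TwoSidedIdeal.mem_ker, TwoSidedIdeal.ker_ringCon_mk']

theorem lieNilThree_quotT4 : LieNilThree QuotT4 := by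
  intro a b c d
  obtain ⟨a, rfl⟩ := T4.ringCon.mk'_surjective a
  obtain ⟨b, rfl⟩ := T4.ringCon.mk'_surjective b
  obtain ⟨c, rfl⟩ := T4.ringCon.mk'_surjective c
  obtain ⟨d, rfl⟩ := T4.ringCon.mk'_surjective d
  have : T4.ringCon.mk' (comm4 a b c d) = 0 :=
    (mk_eq_zero_iff _).2 (TwoSidedIdeal.subset_span ⟨a, b, c, d, rfl⟩)
  simpa [comm4, comm3, comm2, Ring.lie_def] using this

theorem closure_range_mk_gen :
    Subring.closure (Set.range fun i => T4.ringCon.mk' (gen i)) = ⊤ := by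
  have h1 : ∀ f : FreeRingX, T4.ringCon.mk' f ∈
      Subring.closure (Set.range fun i => T4.ringCon.mk' (gen i)) := by
    intro f
    induction f using FreeAlgebra.induction with
    | grade0 r => simp
    | grade1 i => exact Subring.subset_closure ⟨i, rfl⟩
    | mul a b ha hb => rw [map_mul]; exact mul_mem ha hb
    | add a b ha hb => rw [map_add]; exact add_mem ha hb
  refine eq_top_iff.2 fun r _ => ?_
  obtain ⟨f, rfl⟩ := T4.ringCon.mk'_surjective r
  exact h1 f

/-- Additive induction over `T32`, modulo `T4`. -/
theorem T32_induction {p : FreeRingX → Prop} (h4 : ∀ f ∈ T4, p f)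
    (h32 : ∀ q r a b c d e : FreeRingX, p (q * (comm2 a b * comm3 c d e) * r))
    (hadd : ∀ f g, p f → p g → p (f + g)) (hneg : ∀ f, p f → p (-f)) {f : FreeRingX}
    (hf : f ∈ T32) : p f := by
  rw [T32, TwoSidedIdeal.mem_span_iff_mem_addSubgroup_closure] at hf
  induction hf using AddSubgroup.closure_induction with
  | mem f hf =>
    obtain ⟨g, ⟨q, -, s, hs, rfl⟩, r, -, rfl⟩ := hf
    rcases hs with hs | ⟨a, b, c, d, e, rfl⟩
    · exact h4 _ (T4.mul_mem_right _ _ (T4.mul_mem_left _ _ (TwoSidedIdeal.subset_span hs)))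
    · exact h32 q r a b c d e
  | zero => exact h4 0 T4.zero_mem
  | add a b _ _ ha hb => exact hadd a b ha hb
  | neg a _ ha => exact hneg a ha

theorem three_nsmul_mem_T4 {f : FreeRingX} (hf : f ∈ T32) : 3 • f ∈ T4 := by
  refine T32_induction (p := fun f => 3 • f ∈ T4) ?_ ?_ ?_ ?_ hf
  · intro f hf
    exact T4.nsmul_mem 3 hf
  · intro q r a b c d e
    rw [← mk_eq_zero_iff, map_nsmul]
    simpa [comm3, comm2, Ring.lie_def] using
      lieNilThree_quotT4.three_nsmul_mul_lie_mul_triple_mul (T4.ringCon.mk' q) (T4.ringCon.mk' r)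
        (T4.ringCon.mk' a) (T4.ringCon.mk' b) (T4.ringCon.mk' c) (T4.ringCon.mk' d)
        (T4.ringCon.mk' e)
  · intro f g hf hg
    rw [nsmul_add]
    exact T4.add_mem hf hg
  · intro f hf
    rw [smul_neg]
    exact T4.neg_mem hf

theorem orderedSpan_mk_le :
    orderedSpan (fun i => T4.ringCon.mk' (gen i)) 0 ≤
      (AddSubgroup.closure calE).map (T4.ringCon.mk' : FreeRingX →+ QuotT4) := by
  rw [AddMonoidHom.map_closure]
  refine AddSubgroup.closure_mono ?_
  rintro _ ⟨v, l, hv, -, hl, h5, ho, rfl⟩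
  refine ⟨_, (mem_calE_iff _).2 ⟨v, l, hv, hl, h5, ho, rfl⟩, ?_⟩
  change T4.ringCon.mk' _ = _
  rw [map_mul, map_list_prod, map_commProd, List.map_map]
  rfl

theorem exists_mem_closure_calE {f : FreeRingX} (hf : f ∈ T32) :
    ∃ g ∈ AddSubgroup.closure calE, f - g ∈ T4 := by
  refine T32_induction (p := fun f => ∃ g ∈ AddSubgroup.closure calE, f - g ∈ T4) ?_ ?_ ?_ ?_ hf
  · intro f hf
    exact ⟨0, zero_mem _, by simpa using hf⟩
  · intro q r a b c d e
    have := orderedSpan_mk_le <| lieNilThree_quotT4.mul_lie_mul_triple_mul_mem closure_range_mk_gen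
      (T4.ringCon.mk' q) (T4.ringCon.mk' r)
      (T4.ringCon.mk' a) (T4.ringCon.mk' b) (T4.ringCon.mk' c) (T4.ringCon.mk' d)
      (T4.ringCon.mk' e)
    obtain ⟨g, hg, he⟩ := this
    refine ⟨g, hg, ?_⟩
    rw [← mk_eq_zero_iff, map_sub, sub_eq_zero]
    exact Eq.trans (by simp [comm3, comm2, Ring.lie_def]) he.symm
  · intro f g hf hg
    obtain ⟨f', hf', hf⟩ := hf
    obtain ⟨g', hg', hg⟩ := hg
    exact ⟨f' + g', add_mem hf' hg', by rw [add_sub_add_comm]; exact T4.add_mem hf hg⟩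
  · intro f hf
    obtain ⟨f', hf', hf⟩ := hf
    exact ⟨-f', neg_mem hf', by rw [← neg_sub']; exact T4.neg_mem hf⟩

theorem three_nsmul_quotT32T4 (b : QuotT32T4) : 3 • b = 0 := by
  induction b using QuotientAddGroup.induction_on with
  | H f =>
    rw [← QuotientAddGroup.mk_nsmul, QuotientAddGroup.eq_zero_iff]
    exact three_nsmul_mem_T4 f.2

theorem closure_range_cosetE : AddSubgroup.closure (Set.range cosetE) = ⊤ := by
  have key : ∀ g ∈ AddSubgroup.closure calE, ∃ hg : g ∈ AddSubgroup.ofClass T32,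
      (QuotientAddGroup.mk ⟨g, hg⟩ : QuotT32T4) ∈ AddSubgroup.closure (Set.range cosetE) := by
    intro g hg
    induction hg using AddSubgroup.closure_induction with
    | mem g hg => exact ⟨calE_subset_T32 hg, AddSubgroup.subset_closure ⟨⟨g, hg⟩, rfl⟩⟩
    | zero => exact ⟨zero_mem _, zero_mem _⟩
    | add a b _ _ ha hb => exact ⟨add_mem ha.1 hb.1, add_mem ha.2 hb.2⟩
    | neg a _ ha => exact ⟨neg_mem ha.1, neg_mem ha.2⟩
  refine eq_top_iff.2 fun b _ => ?_
  induction b using QuotientAddGroup.induction_on with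
  | H f =>
    obtain ⟨g, hg, hfg⟩ := exists_mem_closure_calE f.2
    obtain ⟨h1, h2⟩ := key g hg
    convert h2 using 1
    rw [eq_comm, QuotientAddGroup.eq]
    change -g + f ∈ T4
    rwa [neg_add_eq_sub]

end Quotient

/-! ### A criterion for Lie nilpotency in characteristic three -/

section Model

attribute [local instance] LieRing.ofAssociativeRing

/-- Elements of a ring that behave like operators on differential forms: `d` is the exterior
derivative, `e i = [d, X i]` multiplies by the `i`-th one-form, and `θ` is a further odd constant.
The `X i` are deformed multiplications by the variables. By the Jacobi identity for the `X i`,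
`lie_X_X` forces `3 θ e i e j e k = 0`; nontrivial examples live in characteristic `3`. -/
structure FormModel (D : Type*) [Ring D] where
  X : ℕ → D
  e : ℕ → D
  d : D
  θ : D
  d_mul_d : d * d = 0
  lie_d_X : ∀ i, ⁅d, X i⁆ = e i
  e_mul_X : ∀ i j, e i * X j = X j * e i
  e_mul_e : ∀ i j, e i * e j = -(e j * e i)
  θ_mul_θ : θ * θ = 0
  θ_mul_X : ∀ i, θ * X i = X i * θ
  θ_mul_e : ∀ i, θ * e i = -(e i * θ)
  θ_mul_d : θ * d = -(d * θ)
  lie_X_X : ∀ i j, ⁅X i, X j⁆ = e i * e j + e i * e j * (θ * d)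

namespace FormModel

variable {D : Type*} [Ring D] (M : FormModel D)

/-- The ring generated by the `X i`. -/
def alg : Subring D := Subring.closure (Set.range M.X)

theorem X_mem (i : ℕ) : M.X i ∈ M.alg := Subring.subset_closure ⟨i, rfl⟩

theorem alg_induction {p : D → Prop} (gen : ∀ i, p (M.X i)) (zero : p 0) (one : p 1)
    (add : ∀ a b, a ∈ M.alg → b ∈ M.alg → p a → p b → p (a + b))
    (neg : ∀ a, a ∈ M.alg → p a → p (-a))
    (mul : ∀ a b, a ∈ M.alg → b ∈ M.alg → p a → p b → p (a * b)) {a : D} (ha : a ∈ M.alg) :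
    p a := by
  induction ha using Subring.closure_induction with
  | mem a ha => obtain ⟨i, rfl⟩ := ha; exact gen i
  | zero => exact zero
  | one => exact one
  | add a b ha hb h1 h2 => exact add a b ha hb h1 h2
  | neg a ha h => exact neg a ha h
  | mul a b ha hb h1 h2 => exact mul a b ha hb h1 h2

/-- The derivation `a ↦ [d, a]`. -/
def δ (a : D) : D := ⁅M.d, a⁆

theorem δ_X (i : ℕ) : M.δ (M.X i) = M.e i := M.lie_d_X i
theorem δ_zero : M.δ 0 = 0 := by simp [δ]
theorem δ_one : M.δ 1 = 0 := by simp [δ, Ring.lie_def]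
theorem δ_add (a b : D) : M.δ (a + b) = M.δ a + M.δ b := by simp [δ]
theorem δ_neg (a : D) : M.δ (-a) = -M.δ a := by simp [δ]
theorem δ_mul (a b : D) : M.δ (a * b) = a * M.δ b + M.δ a * b := lie_mul_right' _ _ _

theorem d_mul_δ (a : D) : M.d * M.δ a = -(M.δ a * M.d) := by
  have h1 : M.d * M.δ a = M.d * M.d * a - M.d * a * M.d := by
    simp only [δ, Ring.lie_def]; noncomm_ring
  have h2 : M.δ a * M.d = M.d * a * M.d - a * (M.d * M.d) := by
    simp only [δ, Ring.lie_def]; noncomm_ring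
  rw [h1, h2, M.d_mul_d]; simp

theorem d_mul_e (i : ℕ) : M.d * M.e i = -(M.e i * M.d) := by rw [← δ_X, d_mul_δ]

theorem θ_mul_alg {a : D} (ha : a ∈ M.alg) : M.θ * a = a * M.θ := by
  refine M.alg_induction (p := fun a => M.θ * a = a * M.θ) M.θ_mul_X ?_ ?_ ?_ ?_ ?_ ha
  · simp
  · simp
  · intro a b _ _ h1 h2; rw [mul_add, add_mul, h1, h2]
  · intro a _ h1; rw [mul_neg, neg_mul, h1]
  · intro a b _ _ h1 h2; rw [← mul_assoc, h1, mul_assoc, h2, mul_assoc]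

theorem e_mul_alg (i : ℕ) {a : D} (ha : a ∈ M.alg) : M.e i * a = a * M.e i := by
  refine M.alg_induction (p := fun a => M.e i * a = a * M.e i) (M.e_mul_X i) ?_ ?_ ?_ ?_ ?_ ha
  · simp
  · simp
  · intro a b _ _ h1 h2; rw [mul_add, add_mul, h1, h2]
  · intro a _ h1; rw [mul_neg, neg_mul, h1]
  · intro a b _ _ h1 h2; rw [← mul_assoc, h1, mul_assoc, h2, mul_assoc]

theorem θ_mul_δ {a : D} (ha : a ∈ M.alg) : M.θ * M.δ a = -(M.δ a * M.θ) := by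
  simp only [δ, Ring.lie_def]
  rw [mul_sub, ← mul_assoc, ← mul_assoc, M.θ_mul_d, M.θ_mul_alg ha, mul_assoc a, M.θ_mul_d, sub_mul,
    neg_mul, mul_assoc, M.θ_mul_alg ha]
  noncomm_ring

theorem e_mul_δ (i : ℕ) {a : D} (ha : a ∈ M.alg) : M.e i * M.δ a = -(M.δ a * M.e i) := by
  have h := M.d_mul_e i
  have h' : M.e i * M.d = -(M.d * M.e i) := by rw [h, neg_neg]
  simp only [δ, Ring.lie_def]
  rw [mul_sub, ← mul_assoc, ← mul_assoc, h', M.e_mul_alg i ha, mul_assoc a, h', sub_mul,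
    neg_mul, mul_assoc, M.e_mul_alg i ha]
  noncomm_ring

/-- `z` is zero modulo `θ`, in the sense that `θ z = 0`. -/
def Null (z : D) : Prop := M.θ * z = 0

namespace Null

variable {M} {z w b : D}

theorem add (hz : M.Null z) (hw : M.Null w) : M.Null (z + w) := by
  rw [Null] at *; rw [mul_add, hz, hw, add_zero]

theorem neg (hz : M.Null z) : M.Null (-z) := by
  rw [Null] at *; rw [mul_neg, hz, neg_zero]

theorem sub (hz : M.Null z) (hw : M.Null w) : M.Null (z - w) := by
  rw [sub_eq_add_neg]; exact hz.add hw.neg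

theorem mul_right (hz : M.Null z) (w : D) : M.Null (z * w) := by
  rw [Null] at *; rw [← mul_assoc, hz, zero_mul]

theorem mul_left (hb : b ∈ M.alg) (hz : M.Null z) : M.Null (b * z) := by
  rw [Null] at *; rw [← mul_assoc, M.θ_mul_alg hb, mul_assoc, hz, mul_zero]

theorem δ_mul_left (hb : b ∈ M.alg) (hz : M.Null z) : M.Null (M.δ b * z) := by
  rw [Null] at *; rw [← mul_assoc, M.θ_mul_δ hb, neg_mul, mul_assoc, hz, mul_zero, neg_zero]

theorem δ (hz : M.Null z) : M.Null (M.δ z) := by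
  rw [Null] at *
  rw [FormModel.δ, Ring.lie_def, mul_sub, ← mul_assoc, ← mul_assoc, M.θ_mul_d, neg_mul, mul_assoc,
    hz]
  simp

theorem zero : M.Null 0 := mul_zero _

end Null

theorem δ_δ_mul_δ (a b : D) : M.δ (M.δ a * M.δ b) = 0 := by
  rw [δ, Ring.lie_def, ← mul_assoc, d_mul_δ, neg_mul, mul_assoc, d_mul_δ, mul_assoc]
  simp

theorem null_lie_X {a : D} (ha : a ∈ M.alg) (i : ℕ) :
    M.Null (⁅a, M.X i⁆ - M.δ a * M.e i) := by
  refine M.alg_induction (p := fun a => M.Null (⁅a, M.X i⁆ - M.δ a * M.e i)) ?_ ?_ ?_ ?_ ?_ ?_ ha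
  · intro j
    have hθ : M.θ * (M.e j * M.e i) = M.e j * M.e i * M.θ := by
      rw [← mul_assoc, M.θ_mul_e, neg_mul, mul_assoc, M.θ_mul_e, mul_neg, neg_neg, mul_assoc]
    rw [M.lie_X_X, M.δ_X, add_sub_cancel_left, Null, ← mul_assoc, hθ, mul_assoc, ← mul_assoc M.θ,
      M.θ_mul_θ, zero_mul, mul_zero]
  · simpa [δ_zero] using Null.zero
  · simpa [δ_one, Ring.lie_def] using Null.zero
  · intro a b _ _ h1 h2
    rw [add_lie, δ_add, add_mul, add_sub_add_comm]; exact h1.add h2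
  · intro a _ h1
    rw [neg_lie, δ_neg, neg_mul, ← neg_sub']; exact h1.neg
  · intro a b ha hb h1 h2
    have e : ⁅a * b, M.X i⁆ - M.δ (a * b) * M.e i =
        a * (⁅b, M.X i⁆ - M.δ b * M.e i) + (⁅a, M.X i⁆ - M.δ a * M.e i) * b := by
      rw [δ_mul, lie_mul_left', add_mul, mul_assoc (M.δ a), ← M.e_mul_alg i hb]
      noncomm_ring
    rw [e]
    exact (Null.mul_left ha h2).add (h1.mul_right b)

/-- Modulo `θ` the commutator is `[a, b] = δ a δ b`, and the `δ b` commute with the `X i` and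
anticommute with each other. The three facts need one another for products. -/
theorem null_aux {b : D} (hb : b ∈ M.alg) : (∀ a ∈ M.alg, M.Null ⁅M.δ b, a⁆) ∧
    (∀ a ∈ M.alg, M.Null (M.δ b * M.δ a + M.δ a * M.δ b)) ∧
    (∀ a ∈ M.alg, M.Null (⁅a, b⁆ - M.δ a * M.δ b)) := by
  refine M.alg_induction (p := fun b => (∀ a ∈ M.alg, M.Null ⁅M.δ b, a⁆) ∧
    (∀ a ∈ M.alg, M.Null (M.δ b * M.δ a + M.δ a * M.δ b)) ∧
    (∀ a ∈ M.alg, M.Null (⁅a, b⁆ - M.δ a * M.δ b))) ?_ ?_ ?_ ?_ ?_ ?_ hb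
  · intro i
    refine ⟨fun a ha => ?_, fun a ha => ?_, fun a ha => ?_⟩
    · rw [δ_X, Ring.lie_def, M.e_mul_alg i ha, sub_self]; exact Null.zero
    · rw [δ_X, M.e_mul_δ i ha, neg_add_cancel]; exact Null.zero
    · rw [δ_X]; exact M.null_lie_X ha i
  · have h0 : M.Null 0 := Null.zero
    simp [δ_zero, h0]
  · have h0 : M.Null 0 := Null.zero
    simp [δ_one, Ring.lie_def, h0]
  · intro b b' hb hb' ⟨h1, h2, h3⟩ ⟨h1', h2', h3'⟩
    refine ⟨fun a ha => ?_, fun a ha => ?_, fun a ha => ?_⟩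
    · rw [δ_add, add_lie]; exact (h1 a ha).add (h1' a ha)
    · rw [δ_add, add_mul, mul_add, add_add_add_comm]; exact (h2 a ha).add (h2' a ha)
    · rw [δ_add, lie_add, mul_add, add_sub_add_comm]; exact (h3 a ha).add (h3' a ha)
  · intro b hb ⟨h1, h2, h3⟩
    refine ⟨fun a ha => ?_, fun a ha => ?_, fun a ha => ?_⟩
    · rw [δ_neg, neg_lie]; exact (h1 a ha).neg
    · rw [δ_neg, neg_mul, mul_neg, ← neg_add]; exact (h2 a ha).neg
    · rw [δ_neg, lie_neg, mul_neg, ← neg_sub']; exact (h3 a ha).neg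
  · intro b b' hb hb' ⟨h1, h2, h3⟩ ⟨h1', h2', h3'⟩
    -- Apply `δ` to `[a, b] = δ a δ b`, whose right-hand side is closed.
    have closed : ∀ b : D, (∀ a ∈ M.alg, M.Null ⁅M.δ b, a⁆) →
        (∀ a ∈ M.alg, M.Null (⁅a, b⁆ - M.δ a * M.δ b)) → ∀ a ∈ M.alg, M.Null ⁅M.δ a, b⁆ := by
      intro b h1 h3 a ha
      have e : ⁅M.δ a, b⁆ = M.δ (⁅a, b⁆ - M.δ a * M.δ b) + ⁅M.δ b, a⁆ := by
        have e1 : M.δ (⁅a, b⁆ - M.δ a * M.δ b) = M.δ ⁅a, b⁆ - M.δ (M.δ a * M.δ b) := by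
          simp [δ]
        rw [e1, δ_δ_mul_δ]
        simp only [δ, Ring.lie_def]
        noncomm_ring
      rw [e]
      exact (h3 a ha).δ.add (h1 a ha)
    have h4 := closed b h1 h3
    have h4' := closed b' h1' h3'
    refine ⟨fun a ha => ?_, fun a ha => ?_, fun a ha => ?_⟩
    · have e : ⁅M.δ (b * b'), a⁆ = b * ⁅M.δ b', a⁆ + ⁅M.δ b, a⁆ * b'
          - (⁅a, b⁆ - M.δ a * M.δ b) * M.δ b' - M.δ b * (⁅a, b'⁆ - M.δ a * M.δ b')
          - (M.δ b * M.δ a + M.δ a * M.δ b) * M.δ b' := by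
        rw [δ_mul]
        simp only [Ring.lie_def]
        noncomm_ring
      rw [e]
      exact (((((h1' a ha).mul_left hb).add ((h1 a ha).mul_right _)).sub
        ((h3 a ha).mul_right _)).sub ((h3' a ha).δ_mul_left hb)).sub ((h2 a ha).mul_right _)
    · have e : M.δ (b * b') * M.δ a + M.δ a * M.δ (b * b') =
          b * (M.δ b' * M.δ a + M.δ a * M.δ b') + ⁅M.δ a, b⁆ * M.δ b'
          + (M.δ b * M.δ a + M.δ a * M.δ b) * b' - M.δ b * ⁅M.δ a, b'⁆ := by
        rw [δ_mul]
        simp only [Ring.lie_def]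
        noncomm_ring
      rw [e]
      exact ((((h2' a ha).mul_left hb).add ((h4 a ha).mul_right _)).add
        ((h2 a ha).mul_right _)).sub ((h4' a ha).δ_mul_left hb)
    · have e : ⁅a, b * b'⁆ - M.δ a * M.δ (b * b') =
          b * (⁅a, b'⁆ - M.δ a * M.δ b') + (⁅a, b⁆ - M.δ a * M.δ b) * b'
          - ⁅M.δ a, b⁆ * M.δ b' := by
        rw [δ_mul]
        simp only [Ring.lie_def]
        noncomm_ring
      rw [e]
      exact (((h3' a ha).mul_left hb).add ((h3 a ha).mul_right _)).sub ((h4 a ha).mul_right _)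

theorem θ_δ_comm {a b : D} (ha : a ∈ M.alg) (hb : b ∈ M.alg) (r : D) :
    M.θ * (M.δ a * (b * r)) = M.θ * (b * (M.δ a * r)) := by
  have := (M.null_aux ha).1 b hb
  rw [Null, Ring.lie_def, mul_sub, sub_eq_zero] at this
  rw [← mul_assoc (M.δ a), ← mul_assoc, this]
  noncomm_ring

theorem θ_δ_anticomm {a b : D} (ha : a ∈ M.alg) (hb : b ∈ M.alg) (r : D) :
    M.θ * (M.δ a * (M.δ b * r)) = -(M.θ * (M.δ b * (M.δ a * r))) := by
  have := (M.null_aux ha).2.1 b hb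
  rw [Null, mul_add] at this
  rw [← mul_assoc (M.δ a), ← mul_assoc, eq_neg_of_add_eq_zero_left this]
  noncomm_ring

theorem θ_lie {a b : D} (ha : a ∈ M.alg) (hb : b ∈ M.alg) (r : D) :
    M.θ * (⁅a, b⁆ * r) = M.θ * (M.δ a * (M.δ b * r)) := by
  have := (M.null_aux hb).2.2 a ha
  rw [Null, mul_sub, sub_eq_zero] at this
  rw [← mul_assoc, this]
  noncomm_ring

end FormModel
end Model

/-! ### The triple commutators of the model -/

section Words

attribute [local instance] LieRing.ofAssociativeRing

namespace FormModel

variable {D : Type*} [Ring D] (M : FormModel D)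

theorem lie_mem {a b : D} (ha : a ∈ M.alg) (hb : b ∈ M.alg) : ⁅a, b⁆ ∈ M.alg :=
  sub_mem (mul_mem ha hb) (mul_mem hb ha)

theorem θ_δ_congr {a u v : D} (ha : a ∈ M.alg) (h : M.θ * u = M.θ * v) :
    M.θ * (M.δ a * u) = M.θ * (M.δ a * v) := by
  rw [← mul_assoc, ← mul_assoc, M.θ_mul_δ ha, neg_mul, neg_mul, mul_assoc, mul_assoc, h]

theorem θ_δ_anticomm₂ {a b c : D} (ha : a ∈ M.alg) (hb : b ∈ M.alg) (hc : c ∈ M.alg) (r : D) :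
    M.θ * (M.δ a * (M.δ b * (M.δ c * r))) = -(M.θ * (M.δ a * (M.δ c * (M.δ b * r)))) := by
  rw [M.θ_δ_congr ha (v := -(M.δ c * (M.δ b * r)))
    (by rw [M.θ_δ_anticomm hb hc, mul_neg]), mul_neg, mul_neg]

theorem θ_δ_anticomm₃ {a b c d : D} (ha : a ∈ M.alg) (hb : b ∈ M.alg) (hc : c ∈ M.alg)
    (hd : d ∈ M.alg) (r : D) : M.θ * (M.δ a * (M.δ b * (M.δ c * (M.δ d * r)))) =
      -(M.θ * (M.δ a * (M.δ b * (M.δ d * (M.δ c * r))))) := by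
  rw [M.θ_δ_congr ha (v := -(M.δ b * (M.δ d * (M.δ c * r))))
    (by rw [M.θ_δ_anticomm₂ hb hc hd, mul_neg]), mul_neg, mul_neg]

theorem θ_δ_δ_comm {a b c : D} (ha : a ∈ M.alg) (hb : b ∈ M.alg) (hc : c ∈ M.alg) (r : D) :
    M.θ * (M.δ a * (M.δ b * (c * r))) = M.θ * (c * (M.δ a * (M.δ b * r))) := by
  rw [M.θ_δ_congr ha (M.θ_δ_comm hb hc r), M.θ_δ_comm ha hc]

theorem θ_δ_δ_δ_comm {a b c f : D} (ha : a ∈ M.alg) (hb : b ∈ M.alg) (hc : c ∈ M.alg)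
    (hf : f ∈ M.alg) :
    M.θ * (M.δ a * (M.δ b * (M.δ c * f))) = M.θ * (f * (M.δ a * (M.δ b * M.δ c))) := by
  have h := M.θ_δ_comm hc hf 1
  rw [mul_one, mul_one] at h
  rw [M.θ_δ_congr ha (M.θ_δ_congr hb h), M.θ_δ_δ_comm ha hb hf]

/-- The formula `[a, b, c] = θ δ a δ b δ c`. -/
def TripleFormula (a b c : D) : Prop := ⁅⁅a, b⁆, c⁆ = M.θ * (M.δ a * (M.δ b * M.δ c))

/-- Skew symmetry of `[a, b] [c, d]` in `b` and `c`. -/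
def PairSkew (a b c d : D) : Prop := ⁅a, b⁆ * ⁅c, d⁆ + ⁅a, c⁆ * ⁅b, d⁆ = 0

variable {M}
variable {a b c a' b' c' d d' : D}

theorem PairSkew.symm (h : PairSkew a b c d) : PairSkew a c b d := by
  rw [PairSkew] at *; rw [← h]; abel

namespace TripleFormula

theorem swap (ha : a ∈ M.alg) (hb : b ∈ M.alg) (h : M.TripleFormula a b c) :
    M.TripleFormula b a c := by
  rw [TripleFormula] at *
  rw [M.θ_δ_anticomm hb ha, ← h, ← lie_skew a b, neg_lie, neg_neg]

theorem mul_right (ha : a ∈ M.alg) (hb : b ∈ M.alg) (hc : c ∈ M.alg)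
    (h : M.TripleFormula a b c) (h' : M.TripleFormula a b c') : M.TripleFormula a b (c * c') := by
  rw [TripleFormula] at *
  rw [lie_mul_right', h, h', δ_mul, mul_add, mul_add, mul_add, M.θ_δ_δ_comm ha hb hc,
    ← mul_assoc c, ← M.θ_mul_alg hc]
  simp only [mul_assoc]

theorem mul_left (ha : a ∈ M.alg) (ha' : a' ∈ M.alg)
    (hb : b ∈ M.alg) (hc : c ∈ M.alg) (h : M.TripleFormula a b c) (h' : M.TripleFormula a' b c)
    (hs : PairSkew a c b a') : M.TripleFormula (a * a') b c := by
  rw [TripleFormula] at *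
  have e : ⁅⁅a * a', b⁆, c⁆ = a * ⁅⁅a', b⁆, c⁆ + ⁅⁅a, b⁆, c⁆ * a'
      - (⁅a, c⁆ * ⁅b, a'⁆ + ⁅a, b⁆ * ⁅c, a'⁆) := by
    simp only [Ring.lie_def]; noncomm_ring
  have h1 := M.θ_δ_δ_δ_comm ha hb hc ha'
  have h2 := M.θ_δ_comm ha ha' (M.δ b * M.δ c)
  rw [e, show ⁅a, c⁆ * ⁅b, a'⁆ + ⁅a, b⁆ * ⁅c, a'⁆ = 0 from hs, h, h', δ_mul, sub_zero, add_mul,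
    mul_add, ← mul_assoc a, ← M.θ_mul_alg ha]
  simp only [mul_assoc] at h1 h2 ⊢
  rw [h1, h2]

end TripleFormula

namespace PairSkew

theorem mul_first (ha : a ∈ M.alg) (hb : b ∈ M.alg) (hc : c ∈ M.alg)
    (h : PairSkew a b c d) (h' : PairSkew a' b c d)
    (h1 : M.TripleFormula c d a') (h2 : M.TripleFormula b d a') : PairSkew (a * a') b c d := by
  rw [PairSkew] at *
  rw [TripleFormula] at h1 h2
  have e : ⁅a * a', b⁆ * ⁅c, d⁆ + ⁅a * a', c⁆ * ⁅b, d⁆ =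
      a * (⁅a', b⁆ * ⁅c, d⁆ + ⁅a', c⁆ * ⁅b, d⁆) + (⁅a, b⁆ * ⁅c, d⁆ + ⁅a, c⁆ * ⁅b, d⁆) * a'
      - ⁅a, b⁆ * ⁅⁅c, d⁆, a'⁆ - ⁅a, c⁆ * ⁅⁅b, d⁆, a'⁆ := by
    simp only [lie_mul_left', add_mul, mul_add]
    rw [mul_assoc ⁅a, b⁆ a', mul_assoc ⁅a, c⁆ a', Ring.lie_def ⁅c, d⁆ a', Ring.lie_def ⁅b, d⁆ a']
    noncomm_ring
  rw [e, h, h', h1, h2, ← mul_assoc ⁅a, b⁆, ← mul_assoc ⁅a, c⁆,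
    ← M.θ_mul_alg (M.lie_mem ha hb), ← M.θ_mul_alg (M.lie_mem ha hc), mul_assoc M.θ,
    mul_assoc M.θ, M.θ_lie ha hb, M.θ_lie ha hc,
    M.θ_δ_anticomm₂ ha hc hb]
  simp

theorem mul_last (ha : a ∈ M.alg) (hb : b ∈ M.alg) (hc : c ∈ M.alg) (hd : d ∈ M.alg)
    (hd' : d' ∈ M.alg) (h : PairSkew a b c d) (h' : PairSkew a b c d')
    (h1 : M.TripleFormula a b d) (h2 : M.TripleFormula a c d) : PairSkew a b c (d * d') := by
  rw [PairSkew] at *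
  rw [TripleFormula] at h1 h2
  have e : ⁅a, b⁆ * ⁅c, d * d'⁆ + ⁅a, c⁆ * ⁅b, d * d'⁆ =
      d * (⁅a, b⁆ * ⁅c, d'⁆ + ⁅a, c⁆ * ⁅b, d'⁆) + (⁅a, b⁆ * ⁅c, d⁆ + ⁅a, c⁆ * ⁅b, d⁆) * d'
      + ⁅⁅a, b⁆, d⁆ * ⁅c, d'⁆ + ⁅⁅a, c⁆, d⁆ * ⁅b, d'⁆ := by
    simp only [lie_mul_right', add_mul, mul_add]
    rw [← mul_assoc ⁅a, b⁆ d, ← mul_assoc ⁅a, c⁆ d, Ring.lie_def ⁅a, b⁆ d, Ring.lie_def ⁅a, c⁆ d]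
    noncomm_ring
  have hl : ∀ x ∈ M.alg, ∀ y ∈ M.alg,
      M.θ * (M.δ a * (M.δ y * (M.δ d * ⁅x, d'⁆))) =
      M.θ * (M.δ a * (M.δ y * (M.δ d * (M.δ x * M.δ d')))) := by
    intro x hx y hy
    have := M.θ_lie hx hd' 1
    rw [mul_one, mul_one] at this
    rw [M.θ_δ_congr ha (M.θ_δ_congr hy (M.θ_δ_congr hd this))]
  rw [e, h, h', h1, h2]
  simp only [mul_assoc, mul_zero, zero_mul, zero_add]
  rw [hl c hc b hb, hl b hb c hc, M.θ_δ_anticomm₃ ha hc hd hb, M.θ_δ_anticomm₂ ha hc hb,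
    M.θ_δ_anticomm₃ ha hb hc hd]
  simp

theorem mul_mid (ha : a ∈ M.alg) (hb : b ∈ M.alg) (hb' : b' ∈ M.alg) (hc : c ∈ M.alg)
    (hd : d ∈ M.alg) (h : PairSkew a b c d) (h' : PairSkew a b' c d)
    (h1 : M.TripleFormula c d b') (h2 : M.TripleFormula a c b) : PairSkew a (b * b') c d := by
  rw [PairSkew] at *
  rw [TripleFormula] at h1 h2
  have e : ⁅a, b * b'⁆ * ⁅c, d⁆ + ⁅a, c⁆ * ⁅b * b', d⁆ =
      b * (⁅a, b'⁆ * ⁅c, d⁆ + ⁅a, c⁆ * ⁅b', d⁆) + (⁅a, b⁆ * ⁅c, d⁆ + ⁅a, c⁆ * ⁅b, d⁆) * b'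
      - ⁅a, b⁆ * ⁅⁅c, d⁆, b'⁆ + ⁅⁅a, c⁆, b⁆ * ⁅b', d⁆ := by
    simp only [lie_mul_right', lie_mul_left', add_mul, mul_add]
    rw [← mul_assoc ⁅a, c⁆ b, mul_assoc ⁅a, b⁆ b', Ring.lie_def ⁅a, c⁆ b, Ring.lie_def ⁅c, d⁆ b']
    noncomm_ring
  have hl : M.θ * (M.δ a * (M.δ c * (M.δ b * ⁅b', d⁆))) =
      M.θ * (M.δ a * (M.δ c * (M.δ b * (M.δ b' * M.δ d)))) := by
    have := M.θ_lie hb' hd 1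
    rw [mul_one, mul_one] at this
    rw [M.θ_δ_congr ha (M.θ_δ_congr hc (M.θ_δ_congr hb this))]
  have hs : M.θ * (M.δ a * (M.δ b * (M.δ c * (M.δ b' * M.δ d)))) =
      -(M.θ * (M.δ a * (M.δ b * (M.δ c * (M.δ d * M.δ b'))))) := by
    have := M.θ_δ_anticomm hb' hd 1
    rw [mul_one, mul_one, ← mul_neg] at this
    rw [M.θ_δ_congr ha (M.θ_δ_congr hb (M.θ_δ_congr hc this))]
    simp
  rw [e, h, h', h1, h2, ← mul_assoc ⁅a, b⁆, ← M.θ_mul_alg (M.lie_mem ha hb), mul_assoc,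
    M.θ_lie ha hb]
  simp only [mul_assoc, mul_zero, zero_mul, zero_add]
  rw [hl, M.θ_δ_anticomm₂ ha hc hb, hs]
  simp

end PairSkew

variable (M)

theorem tripleFormula_X (i j k : ℕ) : M.TripleFormula (M.X i) (M.X j) (M.X k) := by
  have h1 : ⁅M.e i * M.e j, M.X k⁆ = 0 := by
    rw [Ring.lie_def, mul_assoc, M.e_mul_X, ← mul_assoc, M.e_mul_X, mul_assoc, sub_self]
  have h2 : ⁅M.θ * M.d, M.X k⁆ = M.θ * M.e k := by
    rw [lie_mul_left', M.lie_d_X, Ring.lie_def, M.θ_mul_X, sub_self, zero_mul, add_zero]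
  have h3 : M.e i * M.e j * M.θ = M.θ * (M.e i * M.e j) := by
    rw [← mul_assoc, M.θ_mul_e, neg_mul, mul_assoc _ M.θ, M.θ_mul_e, mul_neg, neg_neg, mul_assoc]
  rw [TripleFormula, M.lie_X_X, add_lie, lie_mul_left' (M.e i * M.e j), h1, h2, zero_mul,
    add_zero, zero_add,
    ← mul_assoc, h3, δ_X, δ_X, δ_X]
  simp only [mul_assoc]

theorem pairSkew_X (i j k l : ℕ) : PairSkew (M.X i) (M.X j) (M.X k) (M.X l) := by
  have hu : ∀ i, M.θ * M.d * M.e i = M.e i * (M.θ * M.d) := by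
    intro i
    rw [mul_assoc, M.d_mul_e, mul_neg, ← mul_assoc, M.θ_mul_e, neg_mul, neg_neg, mul_assoc]
  have h : ∀ i j, ⁅M.X i, M.X j⁆ = M.e i * M.e j * (1 + M.θ * M.d) := by
    intro i j; rw [M.lie_X_X, mul_add, mul_one]
  have hc : ∀ k, (1 + M.θ * M.d) * M.e k = M.e k * (1 + M.θ * M.d) := by
    intro k; rw [add_mul, mul_add, hu, one_mul, mul_one]
  have key : ∀ i j k l, ⁅M.X i, M.X j⁆ * ⁅M.X k, M.X l⁆ =
      M.e i * (M.e j * M.e k) * M.e l * (1 + M.θ * M.d) * (1 + M.θ * M.d) := by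
    intro i j k l
    rw [h, h, ← mul_assoc, ← mul_assoc, mul_assoc _ _ (M.e k), hc, ← mul_assoc,
      mul_assoc _ _ (M.e l), hc]
    simp only [mul_assoc]
  rw [PairSkew, key, key, M.e_mul_e j k]
  simp

/-- The monomial in the `X i` given by a word. -/
def mon (w : List ℕ) : D := (w.map M.X).prod

theorem mon_mem (w : List ℕ) : M.mon w ∈ M.alg :=
  list_prod_mem fun a ha => by
    obtain ⟨i, -, rfl⟩ := List.mem_map.1 ha
    exact M.X_mem i

theorem mon_singleton (i : ℕ) : M.mon [i] = M.X i := by simp [mon]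
theorem mon_cons (i : ℕ) (w : List ℕ) : M.mon (i :: w) = M.mon [i] * M.mon w := by simp [mon]

theorem tripleFormula_of_one (a b c : D) (h : a = 1 ∨ b = 1 ∨ c = 1) : M.TripleFormula a b c := by
  rcases h with rfl | rfl | rfl <;> simp [TripleFormula, δ_one, Ring.lie_def]

theorem pairSkew_of_one (a b c d : D) (h : a = 1 ∨ d = 1) : PairSkew a b c d := by
  rcases h with rfl | rfl <;> simp [PairSkew, Ring.lie_def]

theorem pairSkew_one_mid (a c d : D) : PairSkew a 1 c d := by
  simp [PairSkew, Ring.lie_def]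

theorem pairSkew_mon_succ {n : ℕ}
    (hT : ∀ u v w : List ℕ, u.length + v.length + w.length ≤ n →
      M.TripleFormula (M.mon u) (M.mon v) (M.mon w))
    (hS : ∀ u v w t : List ℕ, u.length + v.length + w.length + t.length ≤ n →
      PairSkew (M.mon u) (M.mon v) (M.mon w) (M.mon t))
    (u v w t : List ℕ) (hn : u.length + v.length + w.length + t.length ≤ n + 1) :
    PairSkew (M.mon u) (M.mon v) (M.mon w) (M.mon t) := by
  have mid : ∀ i j (s v w t : List ℕ), v.length + (s.length + 2) + w.length + t.length ≤ n + 1 →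
      PairSkew (M.mon v) (M.mon (i :: j :: s)) (M.mon w) (M.mon t) := by
    intro i j s v w t hn
    rw [mon_cons]
    exact PairSkew.mul_mid (M.mon_mem _) (M.mon_mem _) (M.mon_mem _) (M.mon_mem _) (M.mon_mem _)
      (hS _ _ _ _ (by simp; omega)) (hS _ _ _ _ (by simp; omega))
      (hT _ _ _ (by simp; omega)) (hT _ _ _ (by simp; omega))
  match u, v, w, t, hn with
  | [], v, w, t, _ => exact pairSkew_of_one _ _ _ _ (Or.inl rfl)
  | u, [], w, t, _ => exact pairSkew_one_mid _ _ _
  | u, v, [], t, _ => exact (pairSkew_one_mid _ _ _).symm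
  | u, v, w, [], _ => exact pairSkew_of_one _ _ _ _ (Or.inr rfl)
  | i :: j :: u, v, w, t, hn =>
    rw [mon_cons]
    simp only [List.length_cons] at hn
    exact PairSkew.mul_first (M.mon_mem _) (M.mon_mem _) (M.mon_mem _)
      (hS _ _ _ _ (by simp; omega)) (hS _ _ _ _ (by simp; omega))
      (hT _ _ _ (by simp; omega)) (hT _ _ _ (by simp; omega))
  | u, i :: j :: v, w, t, hn => exact mid i j v u w t (by simpa using hn)
  | u, v, i :: j :: w, t, hn =>
    exact (mid i j w u v t (by simp only [List.length_cons] at hn; omega)).symm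
  | u, v, w, i :: j :: t, hn =>
    rw [mon_cons]
    simp only [List.length_cons] at hn
    exact PairSkew.mul_last (M.mon_mem _) (M.mon_mem _) (M.mon_mem _) (M.mon_mem _) (M.mon_mem _)
      (hS _ _ _ _ (by simp; omega)) (hS _ _ _ _ (by simp; omega))
      (hT _ _ _ (by simp; omega)) (hT _ _ _ (by simp; omega))
  | [i], [j], [k], [l], _ =>
    simp only [mon_singleton]
    exact M.pairSkew_X i j k l

theorem tripleFormula_mon_succ {n : ℕ}
    (hT : ∀ u v w : List ℕ, u.length + v.length + w.length ≤ n →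
      M.TripleFormula (M.mon u) (M.mon v) (M.mon w))
    (hS : ∀ u v w t : List ℕ, u.length + v.length + w.length + t.length ≤ n + 1 →
      PairSkew (M.mon u) (M.mon v) (M.mon w) (M.mon t))
    (u v w : List ℕ) (hn : u.length + v.length + w.length ≤ n + 1) :
    M.TripleFormula (M.mon u) (M.mon v) (M.mon w) := by
  have left : ∀ i j (s v w : List ℕ), (s.length + 2) + v.length + w.length ≤ n + 1 →
      M.TripleFormula (M.mon (i :: j :: s)) (M.mon v) (M.mon w) := by
    intro i j s v w hn
    rw [mon_cons]
    exact TripleFormula.mul_left (M.mon_mem _) (M.mon_mem _) (M.mon_mem _) (M.mon_mem _)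
      (hT _ _ _ (by simp; omega)) (hT _ _ _ (by simp; omega)) (hS _ _ _ _ (by simp; omega))
  match u, v, w, hn with
  | [], v, w, _ => exact M.tripleFormula_of_one _ _ _ (Or.inl rfl)
  | u, [], w, _ => exact M.tripleFormula_of_one _ _ _ (Or.inr (Or.inl rfl))
  | u, v, [], _ => exact M.tripleFormula_of_one _ _ _ (Or.inr (Or.inr rfl))
  | i :: j :: u, v, w, hn => exact left i j u v w (by simpa using hn)
  | u, i :: j :: v, w, hn =>
    exact (left i j v u w (by simp only [List.length_cons] at hn; omega)).swap
      (M.mon_mem _) (M.mon_mem _)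
  | u, v, i :: j :: w, hn =>
    rw [M.mon_cons i]
    simp only [List.length_cons] at hn
    exact TripleFormula.mul_right (M.mon_mem _) (M.mon_mem _) (M.mon_mem _)
      (hT _ _ _ (by simp; omega)) (hT _ _ _ (by simp; omega))
  | [i], [j], [k], _ =>
    simp only [mon_singleton]
    exact M.tripleFormula_X i j k

/-- Both identities hold for monomials, by simultaneous induction on the total degree. -/
theorem mon_aux (n : ℕ) :
    (∀ u v w : List ℕ, u.length + v.length + w.length ≤ n →
      M.TripleFormula (M.mon u) (M.mon v) (M.mon w)) ∧
    (∀ u v w t : List ℕ, u.length + v.length + w.length + t.length ≤ n →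
      PairSkew (M.mon u) (M.mon v) (M.mon w) (M.mon t)) := by
  induction n with
  | zero =>
    refine ⟨fun u v w h => ?_, fun u v w t h => ?_⟩
    · obtain rfl : u = [] := List.length_eq_zero_iff.1 (by omega)
      exact M.tripleFormula_of_one _ _ _ (Or.inl rfl)
    · obtain rfl : u = [] := List.length_eq_zero_iff.1 (by omega)
      exact pairSkew_of_one _ _ _ _ (Or.inl rfl)
  | succ n ih =>
    have hS := M.pairSkew_mon_succ ih.1 ih.2
    exact ⟨M.tripleFormula_mon_succ ih.1 hS, hS⟩

theorem tripleFormula_mon (u v w : List ℕ) : M.TripleFormula (M.mon u) (M.mon v) (M.mon w) :=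
  (M.mon_aux _).1 u v w le_rfl

/-- Additive induction over monomials. -/
theorem mon_induction {p : D → Prop} (mon : ∀ w, p (M.mon w)) (zero : p 0)
    (add : ∀ a b, p a → p b → p (a + b)) (neg : ∀ a, p a → p (-a)) {a : D} (ha : a ∈ M.alg) :
    p a := by
  rw [alg, Subring.mem_closure_iff] at ha
  induction ha using AddSubgroup.closure_induction with
  | mem a ha =>
    obtain ⟨l, hl, rfl⟩ := Submonoid.exists_list_of_mem_closure ha
    obtain ⟨w, rfl⟩ : ∃ w : List ℕ, w.map M.X = l := by
      clear ha
      induction l with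
      | nil => exact ⟨[], rfl⟩
      | cons a l ih =>
        obtain ⟨w, rfl⟩ := ih fun y hy => hl y (by simp [hy])
        obtain ⟨i, rfl⟩ := hl a (by simp)
        exact ⟨i :: w, rfl⟩
    exact mon w
  | zero => exact zero
  | add a b _ _ ha hb => exact add a b ha hb
  | neg a _ ha => exact neg a ha

/-- The ring generated by the `X i` is Lie nilpotent of class at most three: `θ δ a δ b δ c`
is a constant. -/
theorem lie_lie_lie_eq_zero {a b c f : D} (ha : a ∈ M.alg) (hb : b ∈ M.alg) (hc : c ∈ M.alg)
    (hf : f ∈ M.alg) : ⁅⁅⁅a, b⁆, c⁆, f⁆ = 0 := by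
  refine M.mon_induction (p := fun a => ⁅⁅⁅a, b⁆, c⁆, f⁆ = 0) (fun u => ?_)
    (by simp only [zero_lie]) (fun x y hx hy => by simp only [add_lie, hx, hy, add_zero])
    (fun x hx => by simp only [neg_lie, hx, neg_zero]) ha
  refine M.mon_induction (p := fun b => ⁅⁅⁅M.mon u, b⁆, c⁆, f⁆ = 0) (fun v => ?_)
    (by simp only [zero_lie, lie_zero]) (fun x y hx hy => by simp only [add_lie, lie_add, hx, hy, add_zero])
    (fun x hx => by simp only [neg_lie, lie_neg, hx, neg_zero]) hb
  refine M.mon_induction (p := fun c => ⁅⁅⁅M.mon u, M.mon v⁆, c⁆, f⁆ = 0) (fun w => ?_)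
    (by simp only [zero_lie, lie_zero]) (fun x y hx hy => by simp only [add_lie, lie_add, hx, hy, add_zero])
    (fun x hx => by simp only [neg_lie, lie_neg, hx, neg_zero]) hc
  have hT : ⁅⁅M.mon u, M.mon v⁆, M.mon w⁆ = _ := M.tripleFormula_mon u v w
  rw [hT, Ring.lie_def, mul_assoc, mul_assoc, mul_assoc,
    M.θ_δ_δ_δ_comm (M.mon_mem u) (M.mon_mem v) (M.mon_mem w) hf, ← mul_assoc, M.θ_mul_alg hf,
    mul_assoc, sub_self]

end FormModel
end Words

/-! ### Construction of the operators -/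

section Anti

attribute [local instance] LieRing.ofAssociativeRing

variable {D : Type*} [Ring D]

/-- `a` and `b` anticommute. -/
def Anti (a b : D) : Prop := a * b = -(b * a)

namespace Anti

variable {a b c : D}

theorem symm (h : Anti a b) : Anti b a := by rw [Anti] at *; rw [h, neg_neg]
theorem zero_right : Anti a 0 := by simp [Anti]
theorem sub_right (h : Anti a b) (h' : Anti a c) : Anti a (b - c) := by
  rw [Anti] at *; rw [mul_sub, sub_mul, h, h']; abel
theorem sum_right {ι : Type*} (s : Finset ι) (f : ι → D) (h : ∀ i ∈ s, Anti a (f i)) :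
    Anti a (∑ i ∈ s, f i) := by
  rw [Anti, Finset.mul_sum, Finset.sum_mul, ← Finset.sum_neg_distrib]
  exact Finset.sum_congr rfl h
theorem commute_mul (h : Anti a b) (h' : Anti a c) : Commute a (b * c) := by
  rw [Commute, SemiconjBy, ← mul_assoc, h, neg_mul, mul_assoc, h', mul_neg, neg_neg, mul_assoc]

end Anti

/-- Commuting variables `x i`, anticommuting constants `e i` and `θ`, and the operators
`N i = e i ∂ i`. The `e i` with `n ≤ i` vanish, so that the exterior derivative is a finite sum. -/
structure WeylGrassmann (D : Type*) [Ring D] (n : ℕ) where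
  x : ℕ → D
  e : ℕ → D
  N : ℕ → D
  θ : D
  three_eq_zero : (3 : D) = 0
  x_comm : ∀ i j, Commute (x i) (x j)
  e_comm_x : ∀ i j, Commute (e i) (x j)
  θ_comm_x : ∀ i, Commute θ (x i)
  N_mul_x : ∀ i j, N i * x j = x j * N i + if i = j then e j else 0
  e_anti_e : ∀ i j, Anti (e i) (e j)
  e_anti_N : ∀ i j, Anti (e i) (N j)
  N_anti_N : ∀ i j, Anti (N i) (N j)
  θ_anti_θ : Anti θ θ
  θ_anti_e : ∀ i, Anti θ (e i)
  θ_anti_N : ∀ i, Anti θ (N i)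
  θ_mul_θ : θ * θ = 0
  e_mul_e_self : ∀ i, e i * e i = 0
  N_mul_N_self : ∀ i, N i * N i = 0
  N_mul_e_self : ∀ i, N i * e i = 0
  e_of_le : ∀ i, n ≤ i → e i = 0

namespace WeylGrassmann

variable {n : ℕ} (W : WeylGrassmann D n)

/-- The part of the exterior derivative that belongs to the variables `x l`, `l < i`. -/
def dBelow (i : ℕ) : D := ∑ l ∈ Finset.range i, W.N l

/-- The second order operator `∑ e l ∂ l e k ∂ k` over `l < i`, `l ≤ k < n`. The order of the
variables enters here: summed over all `l` and `k` the operator would be zero, as `e l ∂ l` and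
`e k ∂ k` anticommute. -/
def secondOrder (i : ℕ) : D := ∑ l ∈ Finset.range i, W.N l * (W.dBelow n - W.dBelow l)

/-- The correction by which the deformed multiplication differs from `x i`. -/
def corr (i : ℕ) : D := W.e i * W.dBelow i + W.θ * W.e i * W.secondOrder i

/-- The deformed multiplication by the `i`-th variable. -/
def X (i : ℕ) : D := W.x i + W.corr i

theorem anti_dBelow {a : D} (h : ∀ i, Anti a (W.N i)) (i : ℕ) : Anti a (W.dBelow i) :=
  Anti.sum_right _ _ fun l _ => h l

theorem commute_secondOrder {a : D} (h : ∀ i, Anti a (W.N i)) (i : ℕ) :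
    Commute a (W.secondOrder i) :=
  Commute.sum_right _ _ _ fun l _ =>
    (h l).commute_mul ((W.anti_dBelow h _).sub_right (W.anti_dBelow h _))

theorem commute_corr {a : D} (hN : ∀ i, Anti a (W.N i)) (he : ∀ i, Anti a (W.e i))
    (hθ : Anti a W.θ) (i : ℕ) : Commute a (W.corr i) :=
  ((he i).commute_mul (W.anti_dBelow hN i)).add_right
    ((hθ.commute_mul (he i)).mul_right (W.commute_secondOrder hN i))

theorem e_commute_corr (i j : ℕ) : Commute (W.e i) (W.corr j) :=
  W.commute_corr (W.e_anti_N i) (W.e_anti_e i) (W.θ_anti_e i).symm j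

theorem θ_commute_corr (j : ℕ) : Commute W.θ (W.corr j) :=
  W.commute_corr W.θ_anti_N W.θ_anti_e W.θ_anti_θ j

theorem N_commute_corr (i j : ℕ) : Commute (W.N i) (W.corr j) :=
  W.commute_corr (W.N_anti_N i) (fun k => (W.e_anti_N k i).symm) (W.θ_anti_N i).symm j

theorem dBelow_commute_corr (i j : ℕ) : Commute (W.dBelow i) (W.corr j) :=
  Commute.sum_left _ _ _ fun l _ => W.N_commute_corr l j

theorem secondOrder_commute_corr (i j : ℕ) : Commute (W.secondOrder i) (W.corr j) :=
  Commute.sum_left _ _ _ fun l _ => (W.N_commute_corr l j).mul_left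
    ((W.dBelow_commute_corr n j).sub_left (W.dBelow_commute_corr l j))

theorem corr_commute_corr (i j : ℕ) : Commute (W.corr i) (W.corr j) :=
  ((W.e_commute_corr i j).mul_left (W.dBelow_commute_corr i j)).add_left
    (((W.θ_commute_corr j).mul_left (W.e_commute_corr i j)).mul_left
      (W.secondOrder_commute_corr i j))

theorem lie_N_x (i j : ℕ) : ⁅W.N i, W.x j⁆ = if i = j then W.e j else 0 := by
  rw [Ring.lie_def, W.N_mul_x, add_sub_cancel_left]

theorem lie_dBelow_x (i j : ℕ) : ⁅W.dBelow i, W.x j⁆ = if j < i then W.e j else 0 := by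
  have h : ⁅W.dBelow i, W.x j⁆ = ∑ l ∈ Finset.range i, ⁅W.N l, W.x j⁆ := by
    simp only [dBelow, Ring.lie_def, Finset.sum_mul, Finset.mul_sum, Finset.sum_sub_distrib]
  simp [h, W.lie_N_x]

theorem lie_d_x (j : ℕ) : ⁅W.dBelow n, W.x j⁆ = W.e j := by
  rw [lie_dBelow_x]
  split_ifs with h
  · rfl
  · exact (W.e_of_le j (not_lt.1 h)).symm

theorem lie_secondOrder_x (i j : ℕ) : ⁅W.secondOrder i, W.x j⁆ =
    ∑ l ∈ Finset.range i, (W.N l * (W.e j - if j < l then W.e j else 0)) +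
      if j < i then W.e j * (W.dBelow n - W.dBelow j) else 0 := by
  have h : ⁅W.secondOrder i, W.x j⁆ =
      ∑ l ∈ Finset.range i, ⁅W.N l * (W.dBelow n - W.dBelow l), W.x j⁆ := by
    simp only [secondOrder, Ring.lie_def, Finset.sum_mul, Finset.mul_sum, Finset.sum_sub_distrib]
  rw [h]
  simp only [lie_mul_left', sub_lie, W.lie_d_x, W.lie_dBelow_x, W.lie_N_x, Finset.sum_add_distrib]
  simp

theorem dBelow_mul_e (i j : ℕ) : W.dBelow i * W.e j = -(W.e j * W.dBelow i) :=
  (W.anti_dBelow (W.e_anti_N j) i).symm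

theorem lie_secondOrder_x_of_le {i j : ℕ} (h : i ≤ j) :
    ⁅W.secondOrder i, W.x j⁆ = -(W.e j * W.dBelow i) := by
  rw [lie_secondOrder_x, if_neg (not_lt.2 h), add_zero, ← dBelow_mul_e, dBelow, Finset.sum_mul]
  refine Finset.sum_congr rfl fun l hl => ?_
  rw [if_neg (by have := Finset.mem_range.1 hl; omega), sub_zero]

/-- The coefficient of `dBelow j` is `-2 = 1`, by characteristic `3`. -/
theorem lie_secondOrder_x_of_lt {i j : ℕ} (h : j < i) :
    ⁅W.secondOrder i, W.x j⁆ = W.e j * (W.dBelow n + W.dBelow j) := by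
  have hs : ∑ l ∈ Finset.range i, (W.N l * (W.e j - if j < l then W.e j else 0)) =
      W.dBelow j * W.e j := by
    rw [dBelow, Finset.sum_mul]
    refine (Finset.sum_subset (Finset.range_subset_range.2 h.le) fun l _ hl => ?_).symm.trans ?_
    · rcases (not_lt.1 (fun h => hl (Finset.mem_range.2 h))).eq_or_lt with rfl | hjl
      · rw [if_neg (lt_irrefl _), sub_zero, W.N_mul_e_self]
      · rw [if_pos hjl, sub_self, mul_zero]
    · refine Finset.sum_congr rfl fun l hl => ?_
      rw [if_neg (by have := Finset.mem_range.1 hl; omega), sub_zero]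
  have h3 : (3 : D) * (W.e j * W.dBelow j) = 0 := by rw [W.three_eq_zero, zero_mul]
  rw [lie_secondOrder_x, if_pos h, hs, dBelow_mul_e, ← sub_eq_zero, ← neg_zero, ← h3]
  noncomm_ring

theorem lie_corr_x (i j : ℕ) : ⁅W.corr i, W.x j⁆ =
    W.e i * ⁅W.dBelow i, W.x j⁆ + W.θ * W.e i * ⁅W.secondOrder i, W.x j⁆ := by
  have h1 : ⁅W.e i, W.x j⁆ = 0 := (W.e_comm_x i j).lie_eq
  have h2 : ⁅W.θ, W.x j⁆ = 0 := (W.θ_comm_x j).lie_eq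
  rw [corr, add_lie, lie_mul_left', lie_mul_left' (W.θ * W.e i), lie_mul_left' W.θ, h1, h2]
  simp

theorem lie_X_X_eq (i j : ℕ) : ⁅W.X i, W.X j⁆ = ⁅W.corr i, W.x j⁆ - ⁅W.corr j, W.x i⁆ := by
  have h1 : ⁅W.x i, W.x j⁆ = 0 := (W.x_comm i j).lie_eq
  have h2 : ⁅W.corr i, W.corr j⁆ = 0 := (W.corr_commute_corr i j).lie_eq
  rw [X, X, add_lie, lie_add, lie_add, h1, h2, ← lie_skew (W.x i)]
  abel

/-- The two second order terms combine to the full exterior derivative `dBelow n`. -/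
theorem lie_X_X_of_lt {i j : ℕ} (h : j < i) :
    ⁅W.X i, W.X j⁆ = W.e i * W.e j + W.e i * W.e j * (W.θ * W.dBelow n) := by
  have hθ : W.e i * W.e j * W.θ = W.θ * (W.e i * W.e j) :=
    (((W.θ_anti_e i).commute_mul (W.θ_anti_e j))).symm
  rw [lie_X_X_eq, lie_corr_x, lie_corr_x, lie_dBelow_x, lie_dBelow_x, if_pos h,
    if_neg (by omega), lie_secondOrder_x_of_lt W h, lie_secondOrder_x_of_le W h.le,
    ← mul_assoc (W.e i * W.e j), hθ]
  have hj : W.θ * W.e j * -(W.e i * W.dBelow j) = W.θ * (W.e i * W.e j) * W.dBelow j := by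
    rw [W.e_anti_e i j]; noncomm_ring
  rw [hj]
  noncomm_ring

theorem lie_X_X (i j : ℕ) :
    ⁅W.X i, W.X j⁆ = W.e i * W.e j + W.e i * W.e j * (W.θ * W.dBelow n) := by
  rcases lt_trichotomy j i with h | rfl | h
  · exact W.lie_X_X_of_lt h
  · rw [lie_self, W.e_mul_e_self]; simp
  · rw [← lie_skew, W.lie_X_X_of_lt h, W.e_anti_e i j]; noncomm_ring

theorem dBelow_mul_dBelow (i : ℕ) : W.dBelow i * W.dBelow i = 0 := by
  induction i with
  | zero => simp [dBelow]
  | succ i ih =>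
    have h : W.dBelow (i + 1) = W.dBelow i + W.N i := Finset.sum_range_succ _ _
    have h' : W.N i * W.dBelow i = -(W.dBelow i * W.N i) := W.anti_dBelow (W.N_anti_N i) i
    rw [h, add_mul, mul_add, mul_add, ih, h', W.N_mul_N_self]
    simp

/-- The operators `X i` with the exterior derivative form a `FormModel`. -/
def toFormModel : FormModel D where
  X := W.X
  e := W.e
  d := W.dBelow n
  θ := W.θ
  d_mul_d := W.dBelow_mul_dBelow n
  lie_d_X i := by
    rw [X, lie_add, W.lie_d_x, (W.dBelow_commute_corr n i).lie_eq, add_zero]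
  e_mul_X i j := (W.e_comm_x i j).add_right (W.e_commute_corr i j)
  e_mul_e := W.e_anti_e
  θ_mul_θ := W.θ_mul_θ
  θ_mul_X i := (W.θ_comm_x i).add_right (W.θ_commute_corr i)
  θ_mul_e := W.θ_anti_e
  θ_mul_d := W.anti_dBelow W.θ_anti_N n
  lie_X_X := W.lie_X_X

end WeylGrassmann
end Anti

/-! ### The operators on polynomial differential forms -/

section Forms

open MvPolynomial

/-- Differential forms in countably many variables with polynomial coefficients over `𝔽₃`: the
coefficient at `S` belongs to the product of the one-forms with index in `S`. -/
abbrev Form : Type := Finset ℕ →₀ MvPolynomial ℕ (ZMod 3)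

namespace Form

/-- The sign with which the one-form `a` enters the product of the one-forms in `S`. -/
def sgn (a : ℕ) (S : Finset ℕ) : ℤ := (-1) ^ (S.filter (· < a)).card

/-- Exterior multiplication by the one-form `a`. -/
noncomputable def wedge (a : ℕ) : Module.End (ZMod 3) Form :=
  Finsupp.lsum (ZMod 3) fun S =>
    if a ∈ S then 0 else sgn a S • Finsupp.lsingle (insert a S)

/-- An operator on the coefficients. -/
noncomputable def onCoeff :
    Module.End (ZMod 3) (MvPolynomial ℕ (ZMod 3)) →+* Module.End (ZMod 3) Form where
  toFun f := Finsupp.mapRange.linearMap f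
  map_one' := by ext; simp
  map_mul' f g := by ext; simp
  map_zero' := by ext; simp
  map_add' f g := by ext; simp

theorem onCoeff_single (f : Module.End (ZMod 3) (MvPolynomial ℕ (ZMod 3))) (S : Finset ℕ)
    (p : MvPolynomial ℕ (ZMod 3)) :
    onCoeff f (Finsupp.single S p) = Finsupp.single S (f p) := by
  simp [onCoeff]

theorem wedge_single (a : ℕ) (S : Finset ℕ) (p : MvPolynomial ℕ (ZMod 3)) :
    wedge a (Finsupp.single S p) =
      if a ∈ S then 0 else Finsupp.single (insert a S) (sgn a S • p) := by
  rw [wedge, Finsupp.lsum_single]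
  split_ifs <;> simp

theorem sgn_insert {a b : ℕ} {S : Finset ℕ} (hb : b ∉ S) :
    sgn a (insert b S) = if b < a then -sgn a S else sgn a S := by
  rw [sgn, sgn, Finset.filter_insert]
  split_ifs
  · rw [Finset.card_insert_of_notMem (by simp [hb]), pow_succ]; simp
  · rfl

theorem wedge_anti (a b : ℕ) : Anti (wedge a) (wedge b) := by
  refine Finsupp.lhom_ext fun S p => ?_
  simp only [Module.End.mul_apply, LinearMap.neg_apply, wedge_single]
  by_cases hab : a = b
  · subst hab
    split_ifs
    · simp
    · rw [wedge_single, if_pos (Finset.mem_insert_self _ _), neg_zero]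
  by_cases ha : a ∈ S <;> by_cases hb : b ∈ S <;>
    simp only [ha, hb, if_true, if_false, map_zero, neg_zero, wedge_single, Finset.mem_insert,
      or_true]
  rw [if_neg (by tauto), if_neg (by tauto), sgn_insert hb, sgn_insert ha, Finset.insert_comm,
    ← Finsupp.single_neg]
  congr 1
  rcases lt_or_gt_of_ne hab with h | h
  · rw [if_neg (by omega), if_pos h, neg_smul, neg_neg, smul_comm]
  · rw [if_pos h, if_neg (by omega), neg_smul, smul_comm]

theorem wedge_mul_self (a : ℕ) : wedge a * wedge a = 0 := by
  refine Finsupp.lhom_ext fun S p => ?_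
  rw [Module.End.mul_apply, wedge_single, LinearMap.zero_apply]
  split_ifs
  · simp
  · rw [wedge_single, if_pos (Finset.mem_insert_self _ _)]

theorem wedge_commute (a : ℕ) (f : Module.End (ZMod 3) (MvPolynomial ℕ (ZMod 3))) :
    Commute (wedge a) (onCoeff f) := by
  refine Finsupp.lhom_ext fun S p => ?_
  rw [Module.End.mul_apply, Module.End.mul_apply, onCoeff_single, wedge_single, wedge_single]
  split_ifs
  · simp
  · rw [onCoeff_single, map_zsmul]

/-- Multiplication by the variable `i`. -/
noncomputable def mulX (i : ℕ) : Module.End (ZMod 3) Form :=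
  onCoeff (LinearMap.mulLeft (ZMod 3) (X i))

/-- The partial derivative of the coefficients. -/
noncomputable def partialD (i : ℕ) : Module.End (ZMod 3) Form :=
  onCoeff (pderiv i).toLinearMap

theorem mulX_commute (i j : ℕ) : Commute (mulX i) (mulX j) := by
  rw [Commute, SemiconjBy, mulX, mulX, ← map_mul, ← map_mul]
  congr 1
  refine LinearMap.ext fun p => ?_
  simp [mul_left_comm]

theorem partialD_commute (i j : ℕ) : Commute (partialD i) (partialD j) := by
  rw [Commute, SemiconjBy, partialD, partialD, ← map_mul, ← map_mul]
  congr 1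
  have h : ⁅pderiv (R := ZMod 3) i, pderiv (R := ZMod 3) j⁆ = 0 := by
    refine MvPolynomial.derivation_ext fun k => ?_
    rw [Derivation.commutator_apply, pderiv_X, pderiv_X]
    simp [Pi.single_apply, apply_ite]
  refine LinearMap.ext fun p => ?_
  have := congrArg (fun D => D p) h
  rw [Derivation.commutator_apply] at this
  exact sub_eq_zero.1 this

theorem partialD_mul_mulX (i j : ℕ) :
    partialD i * mulX j = mulX j * partialD i + if i = j then 1 else 0 := by
  have h : (pderiv (R := ZMod 3) i).toLinearMap * LinearMap.mulLeft (ZMod 3) (X j) =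
      LinearMap.mulLeft (ZMod 3) (X j) * (pderiv (R := ZMod 3) i).toLinearMap +
        if i = j then 1 else 0 := by
    refine LinearMap.ext fun p => ?_
    by_cases hij : i = j
    · subst hij; simp [Derivation.leibniz]
    · simp [Derivation.leibniz, pderiv_X_of_ne (Ne.symm hij), hij]
  rw [partialD, mulX, ← map_mul, h, map_add, map_mul]
  split_ifs <;> simp

/-- The one-form of the variable `i < n`; the index `0` is reserved for `θ`. -/
noncomputable def oneForm (n i : ℕ) : Module.End (ZMod 3) Form :=
  if i < n then wedge (i + 1) else 0

theorem anti_oneForm {n : ℕ} {f : Module.End (ZMod 3) Form} (h : ∀ a, Anti f (wedge (a + 1)))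
    (i : ℕ) : Anti f (oneForm n i) := by
  rw [oneForm]
  split_ifs
  · exact h i
  · exact Anti.zero_right

theorem oneForm_commute (n i : ℕ) (f : Module.End (ZMod 3) (MvPolynomial ℕ (ZMod 3))) :
    Commute (oneForm n i) (onCoeff f) := by
  rw [oneForm]
  split_ifs
  · exact wedge_commute _ _
  · exact Commute.zero_left _

theorem oneForm_anti (n i j : ℕ) : Anti (oneForm n i) (oneForm n j) :=
  anti_oneForm (fun _ => (anti_oneForm (fun _ => wedge_anti _ _) i).symm) j

theorem oneForm_mul_self (n i : ℕ) : oneForm n i * oneForm n i = 0 := by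
  rw [oneForm]
  split_ifs
  · exact wedge_mul_self _
  · exact mul_zero _

theorem _root_.Anti.mul_commute {D : Type*} [Ring D] {a b c : D} (h : Anti a b)
    (h' : Commute a c) : Anti a (b * c) := by
  rw [Anti, ← mul_assoc, h, neg_mul, mul_assoc, h'.eq, mul_assoc]

/-- The operators on forms for which only the `n` first variables have nonzero one-forms. -/
noncomputable def weylGrassmann (n : ℕ) : WeylGrassmann (Module.End (ZMod 3) Form) n where
  x := mulX
  e := oneForm n
  N i := oneForm n i * partialD i
  θ := wedge 0
  three_eq_zero := by
    have h : (3 : Module.End (ZMod 3) Form) = algebraMap (ZMod 3) _ 3 := (map_ofNat _ 3).symm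
    rw [h, show (3 : ZMod 3) = 0 from rfl, map_zero]
  x_comm := mulX_commute
  e_comm_x i j := oneForm_commute _ _ _
  θ_comm_x i := wedge_commute _ _
  N_mul_x i j := by
    have h : oneForm n i * mulX j = mulX j * oneForm n i := oneForm_commute _ _ _
    rw [mul_assoc, partialD_mul_mulX, mul_add, ← mul_assoc, h, mul_assoc]
    split_ifs with hij
    · rw [mul_one, hij]
    · rw [mul_zero]
  e_anti_e := oneForm_anti n
  e_anti_N i j := (oneForm_anti n i j).mul_commute (oneForm_commute _ _ _)
  N_anti_N i j := by
    refine Anti.mul_commute (Anti.symm ?_) ?_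
    · exact (oneForm_anti n j i).mul_commute (oneForm_commute _ _ _)
    · exact (oneForm_commute _ _ _).mul_left (partialD_commute i j)
  θ_anti_θ := wedge_anti 0 0
  θ_anti_e i := anti_oneForm (fun _ => wedge_anti _ _) i
  θ_anti_N i := (anti_oneForm (fun _ => wedge_anti _ _) i).mul_commute (wedge_commute _ _)
  θ_mul_θ := wedge_mul_self 0
  e_mul_e_self := oneForm_mul_self n
  N_mul_N_self i := by
    have h : Commute (oneForm n i) (partialD i) := oneForm_commute _ _ _
    rw [mul_assoc, ← mul_assoc (partialD i), ← h.eq, ← mul_assoc, ← mul_assoc, oneForm_mul_self]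
    simp
  N_mul_e_self i := by
    have h : Commute (oneForm n i) (partialD i) := oneForm_commute _ _ _
    rw [mul_assoc, ← h.eq, ← mul_assoc, oneForm_mul_self, zero_mul]
  e_of_le i h := if_neg (not_lt.2 h)

end Form
end Forms

/-! ### Linear independence -/

section Evaluation

namespace FormModel

attribute [local instance] LieRing.ofAssociativeRing

variable {D : Type*} [Ring D] (M : FormModel D)

theorem lie_X_X_mul_θ (i j : ℕ) (r : D) :
    ⁅M.X i, M.X j⁆ * (M.θ * r) = M.θ * (M.e i * (M.e j * r)) := by
  have h3 : M.e i * M.e j * M.θ = M.θ * (M.e i * M.e j) := by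
    rw [← mul_assoc, M.θ_mul_e, neg_mul, mul_assoc _ M.θ, M.θ_mul_e, mul_neg, neg_neg, mul_assoc]
  have h4 : M.θ * M.d * M.θ = 0 := by
    rw [M.θ_mul_d, neg_mul, mul_assoc, M.θ_mul_θ, mul_zero, neg_zero]
  rw [M.lie_X_X, add_mul, mul_assoc (M.e i * M.e j), ← mul_assoc (M.θ * M.d), h4, ← mul_assoc, h3]
  simp [mul_assoc]

/-- Up to the factor `θ` a commutator product is a product of one-forms. -/
theorem commProd_X : ∀ l : List ℕ, 3 ≤ l.length → Odd l.length →
    commProd M.X l = M.θ * (l.map M.e).prod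
  | [a, b, c], _, _ => by
    have h : ⁅⁅M.X a, M.X b⁆, M.X c⁆ = _ := M.tripleFormula_X a b c
    rw [commProd, h]
    simp [δ_X]
  | a :: b :: c :: d :: l, _, ho => by
    match l with
    | [] => exact absurd ho (by simp; decide)
    | f :: l =>
      have ho' : Odd (c :: d :: f :: l).length := by
        simpa [Nat.odd_add, Nat.even_add_one, parity_simps] using ho
      rw [commProd, commProd_X (c :: d :: f :: l) (by simp) ho', lie_X_X_mul_θ]
      simp
  | [], h, _ | [_], h, _ | [_, _], h, _ => by simp at h

end FormModel

namespace Form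

open MvPolynomial

/-- The form model in which only the `n` first variables have nonzero one-forms. -/
noncomputable def model (n : ℕ) : FormModel (Module.End (ZMod 3) Form) :=
  (weylGrassmann n).toFormModel

theorem wedge_single_of_lt {a : ℕ} {S : Finset ℕ} (h : ∀ b ∈ S, a < b)
    (p : MvPolynomial ℕ (ZMod 3)) :
    wedge a (Finsupp.single S p) = Finsupp.single (insert a S) p := by
  have h1 : a ∉ S := fun ha => lt_irrefl _ (h a ha)
  have h2 : sgn a S = 1 := by
    rw [sgn, Finset.filter_false_of_mem fun b hb => (h b hb).not_gt]; simp
  rw [wedge_single, if_neg h1, h2, one_smul]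

/-- The index set of the form that represents a commutator product. -/
def support (l : List ℕ) : Finset ℕ := insert 0 (l.map (· + 1)).toFinset

theorem prod_e_apply (n : ℕ) : ∀ l : List ℕ, l.Pairwise (· < ·) → (∀ a ∈ l, a < n) →
    (l.map (model n).e).prod (Finsupp.single ∅ 1) =
      Finsupp.single (l.map (· + 1)).toFinset 1
  | [], _, _ => by simp
  | a :: l, hl, hn => by
    have h := List.pairwise_cons.1 hl
    have he : (model n).e a = wedge (a + 1) := if_pos (hn a (by simp))
    rw [List.map_cons, List.prod_cons, Module.End.mul_apply,
      prod_e_apply n l h.2 fun b hb => hn b (by simp [hb]), he, wedge_single_of_lt]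
    · simp
    · intro b hb
      obtain ⟨c, hc, rfl⟩ := List.mem_map.1 (List.mem_toFinset.1 hb)
      have := h.1 c hc
      omega

theorem commProd_apply (n : ℕ) {l : List ℕ} (hl : l.Pairwise (· < ·)) (hn : ∀ a ∈ l, a < n)
    (h3 : 3 ≤ l.length) (ho : Odd l.length) :
    commProd (model n).X l (Finsupp.single ∅ 1) = Finsupp.single (support l) 1 := by
  have hθ : (model n).θ = wedge 0 := rfl
  rw [(model n).commProd_X l h3 ho, Module.End.mul_apply, prod_e_apply n l hl hn, hθ,
    wedge_single_of_lt, support]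
  intro b hb
  obtain ⟨c, hc, rfl⟩ := List.mem_map.1 (List.mem_toFinset.1 hb)
  omega

/-- The corrections in `X i` only involve derivatives in the variables before the `i`-th. -/
theorem X_apply (n i : ℕ) (S : Finset ℕ) {p : MvPolynomial ℕ (ZMod 3)}
    (hp : ∀ l < i, pderiv l p = 0) :
    (model n).X i (Finsupp.single S p) = Finsupp.single S (X i * p) := by
  have hN : ∀ l < i, (weylGrassmann n).N l (Finsupp.single S p) = 0 := by
    intro l hl
    change (oneForm n l * partialD l) (Finsupp.single S p) = 0
    rw [Module.End.mul_apply, partialD, onCoeff_single]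
    simp [hp l hl]
  have hd : (weylGrassmann n).dBelow i (Finsupp.single S p) = 0 := by
    rw [WeylGrassmann.dBelow, LinearMap.sum_apply]
    exact Finset.sum_eq_zero fun l hl => hN l (Finset.mem_range.1 hl)
  have hs : (weylGrassmann n).secondOrder i (Finsupp.single S p) = 0 := by
    rw [WeylGrassmann.secondOrder, LinearMap.sum_apply]
    refine Finset.sum_eq_zero fun l hl => ?_
    have h : Anti ((weylGrassmann n).N l)
        ((weylGrassmann n).dBelow n - (weylGrassmann n).dBelow l) :=
      (WeylGrassmann.anti_dBelow _ ((weylGrassmann n).N_anti_N l) n).sub_right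
        (WeylGrassmann.anti_dBelow _ ((weylGrassmann n).N_anti_N l) l)
    rw [h, LinearMap.neg_apply, Module.End.mul_apply, hN l (Finset.mem_range.1 hl), map_zero,
      neg_zero]
  change ((weylGrassmann n).x i + (weylGrassmann n).corr i) (Finsupp.single S p) = _
  rw [WeylGrassmann.corr, LinearMap.add_apply, LinearMap.add_apply, Module.End.mul_apply,
    Module.End.mul_apply, hd, hs]
  simp [weylGrassmann, mulX, onCoeff_single]

theorem prod_X_apply (n : ℕ) (S : Finset ℕ) : ∀ v : List ℕ, v.Pairwise (· ≤ ·) →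
    (v.map (model n).X).prod (Finsupp.single S 1) =
      Finsupp.single S (monomial (Multiset.toFinsupp (v : Multiset ℕ)) 1)
  | [], _ => by simp
  | a :: v, hv => by
    have h := List.pairwise_cons.1 hv
    rw [List.map_cons, List.prod_cons, Module.End.mul_apply, prod_X_apply n S v h.2, X_apply]
    · rw [X, monomial_mul, one_mul, ← Multiset.cons_coe, ← Multiset.singleton_add, map_add,
        Multiset.toFinsupp_singleton]
    · intro l hl
      have h0 : l ∉ v := fun hlv => absurd (h.1 l hlv) (not_le.2 hl)
      rw [pderiv_monomial]
      simp [Multiset.toFinsupp_apply, List.count_eq_zero_of_not_mem h0]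

/-- The representation of the free ring by operators on forms. -/
noncomputable def rep (n : ℕ) : FreeRingX →ₐ[ℤ] Module.End (ZMod 3) Form :=
  FreeAlgebra.lift ℤ (model n).X

theorem rep_gen (n i : ℕ) : rep n (gen i) = (model n).X i := FreeAlgebra.lift_ι_apply _ _

theorem rep_mem_alg (n : ℕ) (f : FreeRingX) : rep n f ∈ (model n).alg := by
  induction f using FreeAlgebra.induction with
  | grade0 r => simp
  | grade1 i => rw [rep_gen]; exact (model n).X_mem i
  | mul a b ha hb => rw [map_mul]; exact mul_mem ha hb
  | add a b ha hb => rw [map_add]; exact add_mem ha hb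

theorem rep_eq_zero (n : ℕ) {f : FreeRingX} (hf : f ∈ T4) : rep n f = 0 := by
  have h : T4 ≤ TwoSidedIdeal.ker (rep n) := by
    refine TwoSidedIdeal.span_le.2 ?_
    rintro _ ⟨a, b, c, d, rfl⟩
    rw [SetLike.mem_coe, TwoSidedIdeal.mem_ker]
    have := (model n).lie_lie_lie_eq_zero (rep_mem_alg n a) (rep_mem_alg n b) (rep_mem_alg n c)
      (rep_mem_alg n d)
    simpa [comm4, comm3, comm2, Ring.lie_def] using this
  exact (TwoSidedIdeal.mem_ker _).1 (h hf)

theorem rep_apply (n : ℕ) {v l : List ℕ} (hv : v.Pairwise (· ≤ ·)) (hl : l.Pairwise (· < ·))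
    (hn : ∀ a ∈ l, a < n) (h3 : 3 ≤ l.length) (ho : Odd l.length) :
    rep n ((v.map gen).prod * commProd gen l) (Finsupp.single ∅ 1) =
      Finsupp.single (support l) (monomial (Multiset.toFinsupp (v : Multiset ℕ)) 1) := by
  have h1 : rep n (v.map gen).prod = (v.map (model n).X).prod := by
    rw [map_list_prod, List.map_map]
    congr 2
    exact funext fun i => rep_gen n i
  have h2 : rep n (commProd gen l) = commProd (model n).X l := by
    have := map_commProd (S := Module.End (ZMod 3) Form) (rep n) gen l
    have h : (fun i => rep n (gen i)) = (model n).X := funext fun i => rep_gen n i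
    rw [← h]
    exact this
  rw [map_mul, h1, h2, Module.End.mul_apply, commProd_apply n hl hn h3 ho, prod_X_apply n _ v hv]

/-- The additive map on `T32 / T4` that applies an element to the constant form `1`. -/
noncomputable def evalOne (n : ℕ) : QuotT32T4 →+ Form :=
  QuotientAddGroup.lift _
    ((LinearMap.applyₗ (R := ZMod 3) (Finsupp.single ∅ 1 : Form)).toAddMonoidHom.comp
      ((rep n : FreeRingX →+ Module.End (ZMod 3) Form).comp (AddSubgroup.ofClass T32).subtype))
    (fun f hf => by
      have : rep n f = 0 := rep_eq_zero n hf
      simp [this])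

theorem evalOne_cosetE (n : ℕ) (f : calE) :
    evalOne n (cosetE f) = rep n f (Finsupp.single ∅ 1) := rfl

theorem support_injOn {l l' : List ℕ} (hl : l.Pairwise (· < ·)) (hl' : l'.Pairwise (· < ·))
    (h : support l = support l') : l = l' := by
  have hmem : ∀ a, a ∈ l ↔ a ∈ l' := by
    intro a
    have := Finset.ext_iff.1 h (a + 1)
    simpa [support] using this
  exact List.Pairwise.eq_of_mem_iff hl hl' hmem

/-- Every element of `calE` is determined by the basis form that it yields. -/
theorem exists_key : ∃ key : calE → Finset ℕ × (ℕ →₀ ℕ), Function.Injective key ∧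
    ∀ f : calE, ∃ m, ∀ n, m ≤ n →
      evalOne n (cosetE f) = Finsupp.single (key f).1 (monomial (key f).2 1) := by
  choose v l hv hl h5 ho he using fun f : calE => (mem_calE_iff f).1 f.2
  refine ⟨fun f => (support (l f), Multiset.toFinsupp (v f : Multiset ℕ)), ?_, ?_⟩
  · intro f g hfg
    obtain ⟨h1, h2⟩ := Prod.ext_iff.1 hfg
    have h3 : l f = l g := support_injOn (hl f) (hl g) h1
    have h4 : v f = v g :=
      (Multiset.coe_eq_coe.1 (Multiset.toFinsupp.injective h2)).eq_of_pairwise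
        (fun a b _ _ => le_antisymm) (hv f) (hv g)
    exact Subtype.ext (by rw [he f, he g, h3, h4])
  · intro f
    obtain ⟨m, hm⟩ := (l f).toFinset.exists_nat_subset_range
    refine ⟨m, fun n hmn => ?_⟩
    rw [evalOne_cosetE, he f, rep_apply n (hv f) (hl f) _ (by have := h5 f; omega) (ho f)]
    intro a ha
    exact (Finset.mem_range.1 (hm (List.mem_toFinset.2 ha))).trans_le hmn

end Form

theorem linearIndependent_cosetE [Module (ZMod 3) QuotT32T4] :
    LinearIndependent (ZMod 3) cosetE := by
  obtain ⟨key, hkey, h⟩ := Form.exists_key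
  choose m hm using h
  rw [linearIndependent_iff']
  intro s g hg f hf
  -- Enough variables for all the members of `s`.
  let n := s.sup m
  have h1 := congrArg ((Form.evalOne n).toZModLinearMap 3) hg
  rw [map_sum, map_zero] at h1
  have h2 : ∀ f' ∈ s, (Form.evalOne n).toZModLinearMap 3 (g f' • cosetE f') =
      g f' • Finsupp.single (key f').1 (MvPolynomial.monomial (key f').2 (1 : ZMod 3)) := by
    intro f' hf'
    rw [map_smul]
    congr 1
    exact hm f' n (Finset.le_sup hf')
  rw [Finset.sum_congr rfl h2] at h1
  have h3 := congrArg (fun w : Form => MvPolynomial.coeff (key f).2 (w (key f).1)) h1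
  simp only [Finsupp.finsetSum_apply, Finsupp.smul_apply, MvPolynomial.coeff_sum,
    MvPolynomial.coeff_smul] at h3
  rw [Finset.sum_eq_single f] at h3
  · simpa using h3
  · intro f' _ hne
    by_cases h4 : (key f').1 = (key f).1
    · have h5 : (key f').2 ≠ (key f).2 := fun h5 => hne (hkey (Prod.ext h4 h5))
      simp [h4, MvPolynomial.coeff_monomial, h5]
    · simp [h4]
  · exact fun hn => absurd hf hn

end Evaluation

/-- `T^{(3,2)} / T^{(4)}` is an elementary abelian `3`-group, and for the resulting `𝔽₃`-vector
space structure the images of the elements of `ℰ` form a basis. -/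
theorem theorem1p2 :
    ∃ h : ∀ b : QuotT32T4, 3 • b = 0,
      letI : Module (ZMod 3) QuotT32T4 := AddCommGroup.zmodModule h
      LinearIndependent (ZMod 3) cosetE ∧
        Submodule.span (ZMod 3) (Set.range cosetE) = ⊤ := by
  refine ⟨three_nsmul_quotT32T4, ?_⟩
  let _ : Module (ZMod 3) QuotT32T4 := AddCommGroup.zmodModule three_nsmul_quotT32T4
  refine ⟨linearIndependent_cosetE, eq_top_iff.2 fun b _ => ?_⟩
  have hb : b ∈ AddSubgroup.closure (Set.range cosetE) :=
    closure_range_cosetE ▸ AddSubgroup.mem_top b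
  exact (AddSubgroup.closure_le (Submodule.span (ZMod 3) (Set.range cosetE)).toAddSubgroup).2
    Submodule.subset_span hb
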